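/- Let $d\in\{2,3\}$, let $\Omega\subset\mathbb{R}^d$ be a bounded domain (open, connected, nonempty), let $\epsilon>0$ and $H_\epsilon(x)=\{y:|y-x|<\epsilon\}$, and let $\omega_d$ be the volume of the unit ball of $\mathbb{R}^d$. Assume that $\Omega$ satisfies the interior cone condition: there are $\theta>0$ and $\lambda>0$ such that for every $x\in\Omega$ there is a unit vector $e_x$ for which the spherical cone with apex $x$, radius $\lambda$, axis $e_x$ and aperture angle $2\theta$ is contained in $\Omega$. Let $J:\mathbb{R}\to[0,\infty)$ be bounded and measurable, supported on $[0,1]$, with $J>0$ on $(0,1)$, and put $J^\epsilon(r)=J(r/\epsilon)$. Let $r^e<0<r^c$ and let $g:\mathbb{R}\to\mathbb{R}$ be three times differentiable with $g,g',g'',g'''$ bounded, $g(0)=0$, $g(r)>0$ for $r\neq0$, $g$ convex on $(r^e,r^c)$ with $g''>0$ there, $g$ concave on $(-\infty,r^e]$ and on $[r^c,\infty)$, with finite limits at $\pm\infty$, and $\max_r|g''(r)|=g''(0)$. For $y\ne x$ write $e_{y-x}=\frac{y-x}{|y-x|}$ and $S(y,x,u)=\frac{u(y)-u(x)}{|y-x|}\cdot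 e_{y-x}$. Let $\Pi=\{x\mapsto Qx+c : Q^T=-Q\in\mathbb{R}^{d\times d},\ c\in\mathbb{R}^d\}$ and $$\mathcal V=\Big\{u\in L^\infty(\Omega;\mathbb{R}^d):\ \int_\Omega u\cdot w\,dx=0\ \text{ for all } w\in\Pi\Big\}$$ with the $L^\infty$ norm, and let $\overline{\mathcal V}^2$ be the closure of $\mathcal V$ in $L^2(\Omega;\mathbb{R}^d)$. The force operator $\mathcal L$, its derivative and the stability tensor are $$\mathcal L[u](x)=-\int_{H_\epsilon(x)\cap\Omega}\frac{2J^\epsilon(|y-x|)}{\epsilon^{d+1}\omega_d\sqrt{|y-x|}}\,g'\big(\sqrt{|y-x|}\,S(y,x,u)\big)\,e_{y-x}\,dy,$$ $$D(\mathcal L)[u]w(x)=-\int_{H_\epsilon(x)\cap\Omega}\frac{2J^\epsilon(|y-x|)}{\epsilon^{d+1}\omega_d}\,g''\big(\sqrt{|y-x|}\,S(y,x,u)\big)\,S(y,x,w)\,e_{y-x}\,dy,$$ $$\mathbb A[u](x)=\int_{H_\epsilon(x)\cap\Omega}\frac{J^\epsilon(|y-x|)}{\epsilon^{d+1}\omega_d|y-x|}\,g''\big(\sqrt{|y-x|}\,S(y,x,u)\big)\,e_{y-x}\otimes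 e_{y-x}\,dy.$$ Let $u_0\in\mathcal V$ lie strictly inside the strength domain: there is a closed interval $[a,b]\subset(r^e,r^c)$ with $\sqrt{|y-x|}\,S(y,x,u_0)\in[a,b]$ for all $x\in\Omega$ and all $y\in\Omega\cap H_\epsilon(x)$, $y\neq x$. Then: 1. There is $\gamma>0$ such that $\mathbb A[u_0](x)v\cdot v>\gamma|v|^2$ for all $x\in\Omega$ and all $v\in\mathbb{R}^d\setminus\{0\}$. 2. $\operatorname{Ker}D(\mathcal L)[u_0]=\{0\}$: if $w\in\overline{\mathcal V}^2$ (in particular if $w\in\mathcal V$) and $D(\mathcal L)[u_0]w=0$ a.e. in $\Omega$, then $w=0$. 3. $\mathcal L$ maps $\mathcal V$ into $\mathcal V$, $D(\mathcal L)[u_0]:\mathcal V\to\mathcal V$ is the Fréchet derivative of $\mathcal L$ at $u_0$ with respect to the $L^\infty$ norm, and it is a bijection of $\mathcal V$ onto itself, bounded with bounded inverse $D(\mathcal L)[u_0]^{-1}$ in the $L^\infty$ norm. -/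

import Mathlib

open MeasureTheory
open scoped ENNReal

noncomputable section

namespace Peridynamics

/-- The ambient space `ℝ^d` with its Euclidean structure. -/
abbrev E (d : ℕ) : Type := EuclideanSpace ℝ (Fin d)

/-- Influence functions: bounded, measurable, nonnegative, supported on `[0,1]`, and positive
inside the horizon. -/
structure IsInfluenceFunction (J : ℝ → ℝ) : Prop where
  measurable : Measurable J
  bounded : ∃ C : ℝ, ∀ r, |J r| ≤ C
  nonneg : ∀ r, 0 ≤ J r
  support_subset : Function.support J ⊆ Set.Icc 0 1
  pos : ∀ r ∈ Set.Ioo (0 : ℝ) 1, 0 < J r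

/-- Cohesive potentials `g` with inflection points `re < 0 < rc`. -/
structure IsCohesivePotential (g : ℝ → ℝ) (re rc : ℝ) : Prop where
  re_neg : re < 0
  rc_pos : 0 < rc
  differentiable : ∀ k < 3, Differentiable ℝ (iteratedDeriv k g)
  bounded : ∀ k ≤ 3, ∃ C : ℝ, ∀ r, |iteratedDeriv k g r| ≤ C
  zero : g 0 = 0
  pos : ∀ r, r ≠ 0 → 0 < g r
  convexOn : ConvexOn ℝ (Set.Ioo re rc) g
  concaveOn_left : ConcaveOn ℝ (Set.Iic re) g
  concaveOn_right : ConcaveOn ℝ (Set.Ici rc) g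
  limit_left : ∃ C : ℝ, Filter.Tendsto g Filter.atBot (nhds C)
  limit_right : ∃ C : ℝ, Filter.Tendsto g Filter.atTop (nhds C)
  second_deriv_le : ∀ r, |iteratedDeriv 2 g r| ≤ iteratedDeriv 2 g 0
  second_deriv_pos : ∀ r ∈ Set.Ioo re rc, 0 < iteratedDeriv 2 g r

variable {d : ℕ}

/-- The closed spherical cone with apex `x`, radius `l`, aperture angle `2θ` and axis `e`. -/
def cone (l θ : ℝ) (x e : E d) : Set (E d) :=
  {y | y = x ∨ (‖y - x‖ ≤ l ∧ InnerProductGeometry.angle (y - x) e ≤ θ)}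

/-- The interior cone condition, with radius and angle uniform over `Ω`. -/
def InteriorConeCondition (Ω : Set (E d)) : Prop :=
  ∃ θ : ℝ, 0 < θ ∧ ∃ l : ℝ, 0 < l ∧ ∀ x ∈ Ω, ∃ e : E d, ‖e‖ = 1 ∧ cone l θ x e ⊆ Ω

/-- The unit vector `e_{y-x}`. -/
def bondDir (y x : E d) : E d := ‖y - x‖⁻¹ • (y - x)

/-- The nonlocal strain `S(y,x,u)`. -/
def strain (y x : E d) (u : E d → E d) : ℝ :=
  inner ℝ (‖y - x‖⁻¹ • (u y - u x)) (bondDir y x)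

/-- The neighbourhood `H_ε(x) ∩ Ω`. -/
def nbhd (Ω : Set (E d)) (ε : ℝ) (x : E d) : Set (E d) := Metric.ball x ε ∩ Ω

/-- The volume of the unit ball of `ℝ^d`. -/
def unitBallVolume (d : ℕ) : ℝ := (volume (Metric.ball (0 : E d) 1)).toReal

/-- `u` lies strictly inside the strength domain: the scaled strains of all bonds lie in one
closed interval contained in `(re, rc)`. -/
def StrictlyInsideStrengthDomain (Ω : Set (E d)) (ε re rc : ℝ) (u : E d → E d) : Prop :=
  ∃ a b : ℝ, re < a ∧ b < rc ∧ ∀ x ∈ Ω, ∀ y ∈ nbhd Ω ε x, y ≠ x →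
    Real.sqrt ‖y - x‖ * strain y x u ∈ Set.Icc a b

/-- The peridynamic force `𝓛[u](x)`. -/
def force (Ω : Set (E d)) (ε : ℝ) (J g : ℝ → ℝ) (u : E d → E d) (x : E d) : E d :=
  -∫ y in nbhd Ω ε x,
    (2 * (J (‖y - x‖ / ε) / (ε ^ (d + 1) * unitBallVolume d * Real.sqrt ‖y - x‖)) *
      deriv g (Real.sqrt ‖y - x‖ * strain y x u)) • bondDir y x

/-- The derivative `D(𝓛)[u] w` at `x`. -/
def forceDeriv (Ω : Set (E d)) (ε : ℝ) (J g : ℝ → ℝ) (u w : E d → E d) (x : E d) : E d :=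
  -∫ y in nbhd Ω ε x,
    (2 * (J (‖y - x‖ / ε) / (ε ^ (d + 1) * unitBallVolume d)) *
      iteratedDeriv 2 g (Real.sqrt ‖y - x‖ * strain y x u) * strain y x w) • bondDir y x

/-- The stability tensor `𝔸[u](x)`; `(innerSL ℝ e).smulRight e` is `e ⊗ e`. -/
def stabilityTensor (Ω : Set (E d)) (ε : ℝ) (J g : ℝ → ℝ) (u : E d → E d) (x : E d) :
    E d →L[ℝ] E d :=
  ∫ y in nbhd Ω ε x,
    (J (‖y - x‖ / ε) / (ε ^ (d + 1) * unitBallVolume d * ‖y - x‖) *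
      iteratedDeriv 2 g (Real.sqrt ‖y - x‖ * strain y x u)) •
        (innerSL ℝ (bondDir y x)).smulRight (bondDir y x)

/-- The rigid motions `x ↦ Q x + c` with `Q` skew-symmetric. -/
def rigidMotions (d : ℕ) : Set (E d → E d) :=
  {w | ∃ (Q : Matrix (Fin d) (Fin d) ℝ) (c : E d), Q.transpose = -Q ∧
    ∀ x, w x = WithLp.toLp 2 (Q.mulVec x.ofLp) + c}

/-- The space `𝒱` of essentially bounded displacements orthogonal to the rigid motions, with the
`L^∞(Ω; ℝ^d)` norm. For bounded `Ω` the integrability clause holds automatically. -/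
def V (Ω : Set (E d)) : Submodule ℝ (Lp (E d) ∞ (volume.restrict Ω)) where
  carrier := {u | ∀ w ∈ rigidMotions d,
    IntegrableOn (fun x => inner ℝ (u x) (w x)) Ω ∧ ∫ x in Ω, inner ℝ (u x) (w x) = 0}
  zero_mem' := by
    intro w _
    have h : (fun x => inner ℝ ((0 : Lp (E d) ∞ (volume.restrict Ω)) x) (w x))
        =ᵐ[volume.restrict Ω] fun _ => (0 : ℝ) := by
      filter_upwards [Lp.coeFn_zero (E d) ∞ (volume.restrict Ω)] with x hx
      rw [hx]
      simp
    exact ⟨(integrable_zero _ _ _).congr h.symm, by rw [integral_congr_ae h]; simp⟩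
  add_mem' := by
    intro u v hu hv w hw
    have h : (fun x => inner ℝ ((u + v) x) (w x))
        =ᵐ[volume.restrict Ω] fun x => (inner ℝ (u x) (w x) + inner ℝ (v x) (w x) : ℝ) := by
      filter_upwards [Lp.coeFn_add u v] with x hx
      rw [hx, Pi.add_apply, inner_add_left]
    refine ⟨((hu w hw).1.add (hv w hw).1).congr h.symm, ?_⟩
    rw [integral_congr_ae h, integral_add (hu w hw).1 (hv w hw).1, (hu w hw).2, (hv w hw).2,
      add_zero]
  smul_mem' := by
    intro c u hu w hw
    have h : (fun x => inner ℝ ((c • u) x) (w x))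
        =ᵐ[volume.restrict Ω] fun x => (c * inner ℝ (u x) (w x) : ℝ) := by
      filter_upwards [Lp.coeFn_smul c u] with x hx
      rw [hx, Pi.smul_apply, real_inner_smul_left]
    refine ⟨((hu w hw).1.const_mul c).congr h.symm, ?_⟩
    rw [integral_congr_ae h, integral_const_mul, (hu w hw).2, mul_zero]

/-- The closure of `𝒱` in `L²(Ω; ℝ^d)`. -/
def VL2 (Ω : Set (E d)) : Set (Lp (E d) 2 (volume.restrict Ω)) :=
  closure {v | ∃ u ∈ V Ω, v =ᵐ[volume.restrict Ω] u}

end Peridynamics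

end

/-!
Write the bond weights as a radial kernel `k(y - x)`. The linearized force is
`w ↦ a w - K w`, where the matrix field `a(x)` is twice the stability tensor and `K` is an integral
operator.

* The interior cone condition places in `Ω`, for every `x ∈ Ω`, a ball of fixed radius at a fixed
  distance from `x`, within the horizon. The bonds into this ball point in enough directions to make
  `a` uniformly coercive, so multiplication by `a` is invertible on `L^∞`.
* The bond tensors at `x` depend continuously in `L¹` on `(x, u₀ x)`, which ranges over a compact
  set; by Arzelà–Ascoli `K` is compact on `L^∞`.
* A field in the kernel stores no energy, hence almost every bond within the horizon is unstrained.
  This forces the field to be a rigid motion near every point, thus on the connected set `Ω`, and a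
  rigid motion orthogonal to all rigid motions vanishes.
* By Newton's third law forces are orthogonal to rigid motions. The Fredholm alternative, corrected
  by a finite rank operator on the complement of the orthogonal space, gives bijectivity there.
* The bond force is `C^{1,1}` in the strain, and since `k(z) / √|z|` is integrable for `d ≥ 2` the
  pointwise quadratic Taylor remainder is quadratic in the `L^∞` norm.
-/

noncomputable section

namespace Peridynamics

section Fredholm

variable {X Y : Type*} [NormedAddCommGroup X] [NormedSpace ℝ X]
  [NormedAddCommGroup Y] [NormedSpace ℝ Y]

lemma exists_clm_generalizedInverse [FiniteDimensional ℝ Y] (N : X →L[ℝ] Y) :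
    ∃ S : Y →L[ℝ] X, ∀ x, N (S (N x)) = N x := by
  obtain ⟨s, hs⟩ := N.toLinearMap.rangeRestrict.exists_rightInverse_of_surjective
    N.toLinearMap.range_rangeRestrict
  obtain ⟨S, hS⟩ := s.exists_extend
  refine ⟨S.toContinuousLinearMap, fun x => ?_⟩
  have hSx : S (N x) = s (N.toLinearMap.rangeRestrict x) :=
    LinearMap.congr_fun hS (N.toLinearMap.rangeRestrict x)
  have hsx := LinearMap.congr_fun hs (N.toLinearMap.rangeRestrict x)
  simpa [hSx] using congrArg Subtype.val hsx

variable [CompleteSpace X] {A K : X →L[ℝ] X}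

lemma bijective_isUnit_sub_compact (hA : IsUnit A) (hK : IsCompactOperator K)
    (hinj : Function.Injective (A - K)) : Function.Bijective (A - K) := by
  obtain ⟨A, rfl⟩ := hA
  let L : X →L[ℝ] X := ↑A⁻¹ * K
  have hAL : (A : X →L[ℝ] X) - K = A * (1 - L) := by simp [L, mul_sub]
  have hL : IsCompactOperator L := hK.clm_comp (↑A⁻¹ : X →L[ℝ] X)
  rcases hL.hasEigenvalue_or_mem_resolventSet one_ne_zero with hev | hres
  · obtain ⟨x, hx, hx0⟩ := hev.exists_hasEigenvector
    have hLx : L x = x := by simpa using Module.End.mem_eigenspace_iff.1 hx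
    exact absurd (hinj (by simp [hAL, hLx])) hx0
  · rw [spectrum.mem_resolventSet_iff, map_one] at hres
    rw [hAL, ← ContinuousLinearMap.isUnit_iff_bijective]
    exact A.isUnit.mul hres

lemma bijOn_ker_isUnit_sub_compact [FiniteDimensional ℝ Y] (hA : IsUnit A)
    (hK : IsCompactOperator K) {N : X →L[ℝ] Y} (hN : ∀ x, N ((A - K) x) = 0)
    (hinj : ∀ x, N x = 0 → (A - K) x = 0 → x = 0) :
    Set.BijOn (A - K) {x | N x = 0} {x | N x = 0} := by
  obtain ⟨S, hS⟩ := exists_clm_generalizedInverse N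
  -- `A - K + S ∘ N` is injective on the whole space and agrees with `A - K` on `ker N`.
  have hAKS : A - (K - S ∘L N) = A - K + S ∘L N := by abel
  have hN_apply x : N ((A - (K - S ∘L N)) x) = N x := by
    rw [hAKS, add_apply, map_add, hN, zero_add]
    exact hS x
  have h_apply {x : X} (hx : N x = 0) : (A - (K - S ∘L N)) x = (A - K) x := by
    simp [hAKS, hx]
  have := FiniteDimensional.proper ℝ Y
  have hN_compact : IsCompactOperator N := isCompactOperator_of_locallyCompactSpace_dom N
  have hbij : Function.Bijective (A - (K - S ∘L N)) := by
    refine bijective_isUnit_sub_compact hA (hK.sub (hN_compact.clm_comp S)) ?_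
    refine (injective_iff_map_eq_zero _).2 fun x hx => ?_
    have hNx : N x = 0 := by rw [← hN_apply, hx, map_zero]
    exact hinj x hNx (by rw [← h_apply hNx, hx])
  refine ⟨fun x _ => hN x, fun x hx y hy hxy => hbij.1 ?_, fun y hy => ?_⟩
  · rw [h_apply hx, h_apply hy, hxy]
  · obtain ⟨x, hxy⟩ := hbij.2 y
    have hNx : N x = 0 := by rw [← hN_apply, hxy]; exact hy
    exact ⟨x, hNx, by rw [← h_apply hNx, hxy]⟩

end Fredholm

section Compactness

variable {B G X : Type*} [NormedAddCommGroup B] [NormedSpace ℝ B] [NormedAddCommGroup G]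
  [NormedSpace ℝ G] [TopologicalSpace X] [CompactSpace X]

/-- The operator `b ↦ (x ↦ Φ x b)` of a continuous family `Φ` of operators. -/
def familyOp (Φ : C(X, B →L[ℝ] G)) : B →L[ℝ] C(X, G) :=
  LinearMap.mkContinuous
    { toFun := fun b => ⟨fun x => Φ x b, by fun_prop⟩
      map_add' := fun b c => by ext x; simp
      map_smul' := fun r b => by ext x; simp }
    ‖Φ‖ fun b => (ContinuousMap.norm_le _ (by positivity)).2 fun x =>
      (Φ x).le_of_opNorm_le (Φ.norm_coe_le_norm x) b

lemma isCompactOperator_familyOp [ProperSpace G] (Φ : C(X, B →L[ℝ] G)) :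
    IsCompactOperator (familyOp Φ) := by
  let e := ContinuousMap.linearIsometryBoundedOfCompact X G ℝ
  suffices h : IsCompactOperator (e ∘ familyOp Φ) by
    simpa [Function.comp_def] using h.continuous_comp e.symm.continuous
  let T : B →L[ℝ] BoundedContinuousFunction X G := (e : C(X, G) →L[ℝ] _) ∘L familyOp Φ
  refine (isCompactOperator_iff_isCompact_closure_image_closedBall T.toLinearMap one_pos).2 ?_
  refine BoundedContinuousFunction.arzela_ascoli (Metric.closedBall 0 ‖Φ‖)
    (isCompact_closedBall _ _) _ ?_ ?_
  · rintro _ x ⟨b, hb, rfl⟩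
    rw [mem_closedBall_zero_iff] at hb ⊢
    exact (Φ x).unit_le_opNorm b hb |>.trans (Φ.norm_coe_le_norm x)
  · refine fun x => Metric.equicontinuousAt_of_continuity_modulus (fun y => ‖Φ x - Φ y‖) ?_ _
      (Filter.Eventually.of_forall ?_)
    · exact Continuous.tendsto' (by fun_prop) x 0 (by simp)
    · rintro y ⟨_, b, hb, rfl⟩
      rw [mem_closedBall_zero_iff] at hb
      exact (dist_eq_norm _ _).trans_le ((Φ x - Φ y).unit_le_opNorm b hb)

end Compactness

section Linfty

variable {α H : Type*} [MeasurableSpace α] {μ : Measure α} [NormedAddCommGroup H]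

lemma ae_norm_le_norm_Linfty (u : Lp H ∞ μ) : ∀ᵐ x ∂μ, ‖u x‖ ≤ ‖u‖ := by
  filter_upwards [ae_le_eLpNormEssSup (f := u)] with x hx
  rw [Lp.norm_def, eLpNorm_exponent_top, ← toReal_enorm]
  exact ENNReal.toReal_mono (eLpNorm_exponent_top (f := u) ▸ Lp.eLpNorm_ne_top u) hx

lemma norm_Linfty_le_of_ae_le {u : Lp H ∞ μ} {C : ℝ} (hC : 0 ≤ C) (h : ∀ᵐ x ∂μ, ‖u x‖ ≤ C) :
    ‖u‖ ≤ C := by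
  rw [Lp.norm_def, eLpNorm_exponent_top]
  exact ENNReal.toReal_le_of_le_ofReal hC (eLpNormEssSup_le_of_ae_bound h)

lemma norm_sub_smul_apply_sq_le [InnerProductSpace ℝ H] {A : H →L[ℝ] H} {γ M : ℝ} (hγ : 0 < γ)
    (hM : 0 < M) (hA : ‖A‖ ≤ M) (v : H) (hv : γ * ‖v‖ ^ 2 ≤ inner ℝ (A v) v) :
    ‖v - (γ / M ^ 2) • A v‖ ^ 2 ≤ (1 - (γ / M) ^ 2) * ‖v‖ ^ 2 := by
  have hAv : ‖A v‖ ^ 2 ≤ (M * ‖v‖) ^ 2 := by gcongr; exact A.le_of_opNorm_le hA v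
  calc ‖v - (γ / M ^ 2) • A v‖ ^ 2
      = ‖v‖ ^ 2 - 2 * (γ / M ^ 2) * inner ℝ (A v) v + (γ / M ^ 2) ^ 2 * ‖A v‖ ^ 2 := by
        rw [norm_sub_sq_real, norm_smul, Real.norm_of_nonneg (by positivity),
          real_inner_smul_right, real_inner_comm]
        ring
    _ ≤ ‖v‖ ^ 2 - 2 * (γ / M ^ 2) * (γ * ‖v‖ ^ 2) + (γ / M ^ 2) ^ 2 * (M * ‖v‖) ^ 2 := by gcongr
    _ = (1 - (γ / M) ^ 2) * ‖v‖ ^ 2 := by field_simp; ring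

variable [InnerProductSpace ℝ H]

/-- Multiplication of an `L^∞` vector field by an `L^∞` matrix field. -/
def mulOp (a : Lp (H →L[ℝ] H) ∞ μ) : Lp H ∞ μ →L[ℝ] Lp H ∞ μ :=
  (ContinuousLinearMap.id ℝ (H →L[ℝ] H)).holderL μ ∞ ∞ ∞ a

lemma coeFn_mulOp (a : Lp (H →L[ℝ] H) ∞ μ) (w : Lp H ∞ μ) :
    mulOp a w =ᵐ[μ] fun x => a x (w x) :=
  (ContinuousLinearMap.id ℝ (H →L[ℝ] H)).coeFn_holder a w

lemma isUnit_mulOp {a : Lp (H →L[ℝ] H) ∞ μ} {γ : ℝ} (hγ : 0 < γ)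
    (ha : ∀ᵐ x ∂μ, ∀ v, γ * ‖v‖ ^ 2 ≤ inner ℝ (a x v) v) [CompleteSpace H] :
    IsUnit (mulOp a) := by
  set M := ‖a‖ + γ with hM
  have hM0 : 0 < M := by positivity
  have hγM : 0 ≤ 1 - (γ / M) ^ 2 :=
    sub_nonneg.2 (pow_le_one₀ (by positivity) ((div_le_one hM0).2 (by simp [hM])))
  set q := √(1 - (γ / M) ^ 2)
  have q_nonneg : 0 ≤ q := Real.sqrt_nonneg _
  have hq : q < 1 := by
    rw [Real.sqrt_lt' one_pos, one_pow, sub_lt_self_iff]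
    positivity
  have hsmall : ‖(1 : Lp H ∞ μ →L[ℝ] Lp H ∞ μ) - (γ / M ^ 2) • mulOp a‖ ≤ q := by
    refine ContinuousLinearMap.opNorm_le_bound _ q_nonneg fun w => ?_
    refine norm_Linfty_le_of_ae_le (by positivity) ?_
    filter_upwards [ae_norm_le_norm_Linfty w, ae_norm_le_norm_Linfty a, ha, coeFn_mulOp a w,
      Lp.coeFn_sub w ((γ / M ^ 2) • mulOp a w), Lp.coeFn_smul (γ / M ^ 2) (mulOp a w)]
      with x hwx hax hx hmul hsub hsmul
    change ‖(w - (γ / M ^ 2) • mulOp a w) x‖ ≤ _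
    rw [hsub, Pi.sub_apply, hsmul, Pi.smul_apply, hmul]
    refine le_trans (le_of_sq_le_sq ?_ (by positivity)) (mul_le_mul_of_nonneg_left hwx q_nonneg)
    rw [mul_pow, Real.sq_sqrt hγM]
    exact norm_sub_smul_apply_sq_le hγ hM0 (hax.trans (by simp [hM, hγ.le])) _ (hx _)
  have hunit : IsUnit ((γ / M ^ 2) • mulOp a) := by
    simpa using isUnit_one_sub_of_norm_lt_one
      (x := (1 : Lp H ∞ μ →L[ℝ] Lp H ∞ μ) - (γ / M ^ 2) • mulOp a) (hsmall.trans_lt hq)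
  exact (isUnit_smul_iff (Units.mk0 (γ / M ^ 2) (by positivity)) _).1 hunit

end Linfty

section Pullback

variable {α X H : Type*} [MeasurableSpace α] [TopologicalSpace X] [CompactSpace X]
  [MeasurableSpace X] [BorelSpace X] [NormedAddCommGroup H] [NormedSpace ℝ H]
  [SecondCountableTopologyEither X H] {μ : Measure α} [IsFiniteMeasure μ] {ι : α → X}

/-- The operator `f ↦ f ∘ ι` from continuous to essentially bounded functions. -/
def pullback (μ : Measure α) [IsFiniteMeasure μ] (hι : Measurable ι) :
    C(X, H) →L[ℝ] Lp H ∞ μ :=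
  (Lp.compMeasurePreservingₗᵢ ℝ ι (hι.measurePreserving μ)).toContinuousLinearMap ∘L
    ContinuousMap.toLp ∞ (μ.map ι) ℝ

lemma coeFn_pullback (hι : Measurable ι) (f : C(X, H)) : pullback μ hι f =ᵐ[μ] f ∘ ι :=
  (Lp.coeFn_compMeasurePreserving _ (hι.measurePreserving μ)).trans
    (hι.measurePreserving μ |>.quasiMeasurePreserving.ae (ContinuousMap.coeFn_toLp _ f))

end Pullback

section NonlocalOperator

variable {α X H : Type*} [MeasurableSpace α] [TopologicalSpace X] [CompactSpace X]
  [MeasurableSpace X] [BorelSpace X] [NormedAddCommGroup H] [InnerProductSpace ℝ H]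
  [FiniteDimensional ℝ H] {μ : Measure α} [IsFiniteMeasure μ] {ι : α → X}

/-- The continuous family of functionals `w ↦ ∫ y, κ x y (w y)` on `L^∞`. -/
def pairingFamily (κ : C(X, Lp (H →L[ℝ] H) 1 μ)) : C(X, Lp H ∞ μ →L[ℝ] H) :=
  ((ContinuousLinearMap.id ℝ (H →L[ℝ] H)).lpPairing μ 1 ∞ : C(_, _)).comp κ

/-- The continuous matrix field `x ↦ ∫ y, κ x y`. -/
def totalMass (κ : C(X, Lp (H →L[ℝ] H) 1 μ)) : C(X, H →L[ℝ] H) :=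
  ⟨fun x => ∫ y, κ x y ∂μ, continuous_integral.comp κ.continuous⟩

/-- The operator `w ↦ (x ↦ ∫ y, κ (ι x) y (w x - w y))` on `L^∞`, written as a multiplication
operator minus a compact one. -/
def nonlocalOp (κ : C(X, Lp (H →L[ℝ] H) 1 μ)) (hι : Measurable ι) : Lp H ∞ μ →L[ℝ] Lp H ∞ μ :=
  mulOp (pullback μ hι (totalMass κ)) - pullback μ hι ∘L familyOp (pairingFamily κ)

lemma coeFn_nonlocalOp (κ : C(X, Lp (H →L[ℝ] H) 1 μ)) (hι : Measurable ι) (w : Lp H ∞ μ) :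
    nonlocalOp κ hι w =ᵐ[μ] fun x => ∫ y, κ (ι x) y (w x - w y) ∂μ := by
  set a := pullback μ hι (totalMass κ)
  set Kw := pullback μ hι (familyOp (pairingFamily κ) w)
  filter_upwards [Lp.coeFn_sub (mulOp a w) Kw, coeFn_mulOp a w, coeFn_pullback hι (totalMass κ),
    coeFn_pullback hι (familyOp (pairingFamily κ) w)] with x hsub hmul ha hK
  have hκ : Integrable (κ (ι x)) μ := L1.integrable_coeFn _
  have hκw : Integrable (fun y => κ (ι x) y (w y)) μ :=
    memLp_one_iff_integrable.1 <|
      (ContinuousLinearMap.id ℝ (H →L[ℝ] H)).memLp_of_bilin 1 (Lp.memLp (κ (ι x))) (Lp.memLp w)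
  calc nonlocalOp κ hι w x = a x (w x) - Kw x := by rw [← hmul]; exact hsub
    _ = (∫ y, κ (ι x) y ∂μ) (w x) - ∫ y, κ (ι x) y (w y) ∂μ := by
      rw [ha, hK]
      exact congrArg _ (ContinuousLinearMap.lpPairing_eq_integral _ _ _)
    _ = ∫ y, κ (ι x) y (w x - w y) ∂μ := by
      rw [ContinuousLinearMap.integral_apply hκ,
        ← integral_sub (hκ.apply_continuousLinearMap _) hκw]
      simp only [map_sub]

lemma bijOn_ker_nonlocalOp {Y : Type*} [NormedAddCommGroup Y] [NormedSpace ℝ Y]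
    [FiniteDimensional ℝ Y] {κ : C(X, Lp (H →L[ℝ] H) 1 μ)} {hι : Measurable ι} {γ : ℝ}
    (hγ : 0 < γ) (hκ : ∀ᵐ x ∂μ, ∀ v, γ * ‖v‖ ^ 2 ≤ inner ℝ ((∫ y, κ (ι x) y ∂μ) v) v)
    {N : Lp H ∞ μ →L[ℝ] Y} (hN : ∀ w, N (nonlocalOp κ hι w) = 0)
    (hinj : ∀ w, N w = 0 → nonlocalOp κ hι w = 0 → w = 0) :
    Set.BijOn (nonlocalOp κ hι) {w | N w = 0} {w | N w = 0} := by
  have hcoercive : ∀ᵐ x ∂μ, ∀ v, γ * ‖v‖ ^ 2 ≤ inner ℝ (pullback μ hι (totalMass κ) x v) v := by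
    filter_upwards [hκ, coeFn_pullback hι (totalMass κ)] with x hx hpull
    rw [hpull]
    exact hx
  have := FiniteDimensional.proper ℝ H
  exact bijOn_ker_isUnit_sub_compact (isUnit_mulOp hγ hcoercive)
    ((isCompactOperator_familyOp (pairingFamily κ)).clm_comp (pullback μ hι)) hN hinj

end NonlocalOperator

section Bond

variable {F : Type*} [NormedAddCommGroup F] [InnerProductSpace ℝ F]

/-- The unit vector in the direction of `z`, with `dir 0 = 0`. -/
def dir (z : F) : F := ‖z‖⁻¹ • z

/-- The rank one operator `e ⊗ e`. -/
def dyad (e : F) : F →L[ℝ] F := (innerSL ℝ e).smulRight e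

/-- The scaled strain `√|y - x| S(y, x, u)` of the bond `z = y - x` with relative displacement
`p = u y - u x`. -/
def stretch (z p : F) : ℝ := (√‖z‖)⁻¹ * inner ℝ p (dir z)

/-- The tensor `k(z) h(s) e ⊗ e` of the bond `z` with direction `e`, strain `s` and relative
displacement `p`. -/
def bondTensor (k : F → ℝ) (h : ℝ → ℝ) (z p : F) : F →L[ℝ] F :=
  (k z * h (stretch z p)) • dyad (dir z)

lemma dyad_apply (e v : F) : dyad e v = (inner ℝ e v : ℝ) • e := rfl

lemma norm_dir_le (z : F) : ‖dir z‖ ≤ 1 := by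
  rw [dir, norm_smul, norm_inv, norm_norm]
  exact inv_mul_le_one

lemma dir_neg (z : F) : dir (-z) = -dir z := by simp [dir]

lemma norm_smul_dir (z : F) : ‖z‖ • dir z = z := by
  by_cases hz : z = 0
  · simp [hz, dir]
  · rw [dir, smul_smul, mul_inv_cancel₀ (norm_ne_zero_iff.2 hz), one_smul]

lemma inner_dir_mul_norm (z v : F) : inner ℝ (dir z) v * ‖z‖ = inner ℝ z v := by
  rw [mul_comm, ← real_inner_smul_left, norm_smul_dir]

lemma norm_dyad_dir_le (z : F) : ‖dyad (dir z)‖ ≤ 1 := by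
  rw [dyad, ContinuousLinearMap.norm_smulRight_apply, innerSL_apply_norm]
  exact mul_le_one₀ (norm_dir_le z) (norm_nonneg _) (norm_dir_le z)

lemma continuous_dyad : Continuous (dyad : F → F →L[ℝ] F) :=
  (show Continuous fun e : F => ContinuousLinearMap.smulRightL ℝ F F (innerSL ℝ e) e by fun_prop)

lemma continuousAt_dir {z : F} (hz : z ≠ 0) : ContinuousAt dir z := by
  have : ‖z‖ ≠ 0 := norm_ne_zero_iff.2 hz
  unfold dir
  fun_prop (disch := assumption)

lemma continuousAt_stretch {z p : F} (hz : z ≠ 0) :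
    ContinuousAt (fun q : F × F => stretch q.1 q.2) (z, p) := by
  have hz' : √‖z‖ ≠ 0 := (Real.sqrt_pos.2 (norm_pos_iff.2 hz)).ne'
  have hdir : ContinuousAt (fun q : F × F => dir q.1) (z, p) :=
    ContinuousAt.comp (f := Prod.fst) (x := (z, p)) (continuousAt_dir hz) continuousAt_fst
  have hsqrt : ContinuousAt (fun q : F × F => (√‖q.1‖)⁻¹) (z, p) :=
    ContinuousAt.inv₀ (by fun_prop) hz'
  exact hsqrt.mul (continuousAt_snd.inner hdir)

lemma stretch_neg_neg (z p : F) : stretch (-z) (-p) = stretch z p := by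
  simp [stretch, dir_neg]

lemma stretch_add (z p q : F) : stretch z (p + q) = stretch z p + stretch z q := by
  simp [stretch, inner_add_left, mul_add]

lemma abs_stretch_le (z p : F) : |stretch z p| ≤ (√‖z‖)⁻¹ * ‖p‖ := by
  rw [stretch, abs_mul, abs_of_nonneg (by positivity)]
  gcongr
  exact (abs_real_inner_le_norm _ _).trans
    (mul_le_of_le_one_right (norm_nonneg _) (norm_dir_le z))

variable {k : F → ℝ} {h : ℝ → ℝ} {C : ℝ}

lemma bondTensor_apply (k : F → ℝ) (h : ℝ → ℝ) (z p v : F) :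
    bondTensor k h z p v = (k z * h (stretch z p) * inner ℝ (dir z) v) • dir z := by
  rw [bondTensor, smul_apply, dyad_apply, smul_smul]

lemma inner_bondTensor_apply (k : F → ℝ) (h : ℝ → ℝ) (z p v w : F) :
    inner ℝ (bondTensor k h z p v) w
      = k z * h (stretch z p) * (inner ℝ (dir z) v * inner ℝ (dir z) w) := by
  rw [bondTensor_apply, real_inner_smul_left, mul_assoc]

lemma bondTensor_neg_neg (hk : ∀ z, k (-z) = k z) (z p : F) :
    bondTensor k h (-z) (-p) = bondTensor k h z p := by
  ext v
  simp [bondTensor_apply, hk, stretch_neg_neg, dir_neg]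

lemma norm_bondTensor_le (hh : ∀ r, |h r| ≤ C) (z p : F) : ‖bondTensor k h z p‖ ≤ C * ‖k z‖ := by
  rw [bondTensor, norm_smul, norm_mul, mul_comm C]
  refine (mul_le_of_le_one_right (by positivity) (norm_dyad_dir_le z)).trans ?_
  gcongr
  exact hh _

variable [MeasurableSpace F] [BorelSpace F] [SecondCountableTopology F]

lemma measurable_dir : Measurable (dir : F → F) := by
  unfold dir
  fun_prop

lemma measurable_stretch : Measurable fun q : F × F => stretch q.1 q.2 := by
  have hdir : Measurable fun q : F × F => dir q.1 := measurable_dir.comp measurable_fst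
  exact measurable_fst.norm.sqrt.inv.mul (measurable_snd.inner hdir)

lemma measurable_bondTensor (hk : Measurable k) (hh : Measurable h) :
    Measurable fun q : F × F => bondTensor k h q.1 q.2 :=
  ((hk.comp measurable_fst).mul (hh.comp measurable_stretch)).smul
    (continuous_dyad.measurable.comp (measurable_dir.comp measurable_fst))

end Bond

section AnalyticContinuation

lemma ae_restrict_of_locally_ae_restrict {M : Type*} [TopologicalSpace M]
    [SecondCountableTopology M] [MeasurableSpace M] {μ : Measure M} {Ω : Set M} {p : M → Prop}
    (h : ∀ z ∈ Ω, ∃ U, IsOpen U ∧ z ∈ U ∧ ∀ᵐ x ∂μ.restrict U, p x) :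
    ∀ᵐ x ∂μ.restrict Ω, p x := by
  choose! U hU hzU hp using h
  obtain ⟨T, hTΩ, hT, hcover⟩ := TopologicalSpace.isOpen_biUnion_countable Ω U hU
  have hΩT : Ω ⊆ ⋃ z ∈ T, U z := hcover ▸ fun z hz => Set.mem_biUnion hz (hzU z hz)
  exact ae_restrict_of_ae_restrict_of_subset hΩT
    ((ae_restrict_biUnion_iff U hT p).2 fun z hz => hp z (hTΩ hz))

variable {M G : Type*} [NormedAddCommGroup M] [NormedSpace ℝ M] [MeasurableSpace M]
  [NormedAddCommGroup G] [NormedSpace ℝ G] {μ : Measure M} [μ.IsOpenPosMeasure] {U Ω : Set M}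

lemma eq_of_ae_eq_restrict_of_analyticOnNhd {f g : M → G} (hf : AnalyticOnNhd ℝ f Set.univ)
    (hg : AnalyticOnNhd ℝ g Set.univ) (hU : IsOpen U) (hne : U.Nonempty)
    (h : f =ᵐ[μ.restrict U] g) : f = g := by
  have hEq : Set.EqOn f g U := Measure.eqOn_open_of_ae_eq h hU
    (hf.continuousOn.mono (Set.subset_univ _)) (hg.continuousOn.mono (Set.subset_univ _))
  obtain ⟨x, hx⟩ := hne
  exact hf.eq_of_eventuallyEq hg (hEq.eventuallyEq_of_mem (hU.mem_nhds hx))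

lemma exists_ae_eq_of_locally_ae_eq [SecondCountableTopology M] {𝒜 : Set (M → G)}
    (h𝒜 : ∀ f ∈ 𝒜, AnalyticOnNhd ℝ f Set.univ) (hconn : IsConnected Ω) {w : M → G}
    (hloc : ∀ z ∈ Ω, ∃ U, IsOpen U ∧ z ∈ U ∧ ∃ f ∈ 𝒜, w =ᵐ[μ.restrict U] f) :
    ∃ f ∈ 𝒜, w =ᵐ[μ.restrict Ω] f := by
  choose! U hU hzU f hf hwf using hloc
  have hconst {x y : M} (hx : x ∈ Ω) (hy : y ∈ Ω) : f x = f y := by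
    refine hconn.isPreconnected.induction₂ (fun x y => f x = f y) (fun x hx => ?_)
      (fun _ _ _ _ _ _ => Eq.trans) (fun _ _ _ _ => Eq.symm) hx hy
    filter_upwards [self_mem_nhdsWithin,
      mem_nhdsWithin_of_mem_nhds ((hU x hx).mem_nhds (hzU x hx))] with y hy hyx
    refine eq_of_ae_eq_restrict_of_analyticOnNhd (μ := μ) (h𝒜 _ (hf x hx)) (h𝒜 _ (hf y hy))
      ((hU x hx).inter (hU y hy)) ⟨y, hyx, hzU y hy⟩ ?_
    filter_upwards [ae_restrict_of_ae_restrict_of_subset Set.inter_subset_left (hwf x hx),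
      ae_restrict_of_ae_restrict_of_subset Set.inter_subset_right (hwf y hy)] with z hzx hzy
    exact hzx.symm.trans hzy
  obtain ⟨z, hz⟩ := hconn.nonempty
  refine ⟨f z, hf z hz, ae_restrict_of_locally_ae_restrict fun x hx => ?_⟩
  exact ⟨U x, hU x hx, hzU x hx, hconst hx hz ▸ hwf x hx⟩

end AnalyticContinuation

section Rigidity

variable {F : Type*} [NormedAddCommGroup F] [InnerProductSpace ℝ F]

/-- The skew-symmetric endomorphisms, which are the linear parts of the rigid motions. -/
def skew (F : Type*) [NormedAddCommGroup F] [InnerProductSpace ℝ F] : Submodule ℝ (F →L[ℝ] F) where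
  carrier := {A | ∀ v, inner ℝ (A v) v = 0}
  zero_mem' := by simp
  add_mem' hA hB v := by rw [add_apply, inner_add_left, hA, hB, add_zero]
  smul_mem' c A hA v := by rw [smul_apply, real_inner_smul_left, hA, mul_zero]

/-- The rigid motion `x ↦ Q x + c` with parameters `q = (Q, c)`. -/
def rigidMotion (q : skew F × F) (x : F) : F := (q.1 : F →L[ℝ] F) x + q.2

lemma analyticOnNhd_rigidMotion (q : skew F × F) : AnalyticOnNhd ℝ (rigidMotion q) Set.univ :=
  ((q.1 : F →L[ℝ] F).analyticOnNhd _).add analyticOnNhd_const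

lemma inner_rigidMotion_sub (q : skew F × F) (x y : F) :
    inner ℝ (rigidMotion q y - rigidMotion q x) (y - x) = 0 := by
  rw [rigidMotion, rigidMotion, add_sub_add_right_eq_sub, ← map_sub]
  exact q.1.2 _

variable [MeasurableSpace F] {ν : Measure F} {U Ω : Set F} {w : F → F}

/-- The directions along which the component of `w` is `ν`-almost everywhere an affine function. -/
def affineDirections (ν : Measure F) (w : F → F) : Submodule ℝ F where
  carrier := {v | ∃ (φ : F →L[ℝ] ℝ) (c : ℝ), ∀ᵐ y ∂ν, inner ℝ (w y) v = φ y + c}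
  zero_mem' := ⟨0, 0, by simp⟩
  add_mem' := by
    rintro v v' ⟨φ, c, h⟩ ⟨φ', c', h'⟩
    refine ⟨φ + φ', c + c', ?_⟩
    filter_upwards [h, h'] with y hy hy'
    rw [inner_add_right, hy, hy', add_apply]
    ring
  smul_mem' := by
    rintro t v ⟨φ, c, h⟩
    refine ⟨t • φ, t * c, ?_⟩
    filter_upwards [h] with y hy
    rw [real_inner_smul_right, hy, smul_apply, smul_eq_mul, mul_add]

lemma sub_mem_affineDirections {x₀ x₁ : F} (h₀ : ∀ᵐ y ∂ν, inner ℝ (w y - w x₀) (y - x₀) = 0)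
    (h₁ : ∀ᵐ y ∂ν, inner ℝ (w y - w x₁) (y - x₁) = 0) : x₁ - x₀ ∈ affineDirections ν w := by
  refine ⟨innerSL ℝ (w x₀) - innerSL ℝ (w x₁), inner ℝ (w x₁) x₁ - inner ℝ (w x₀) x₀, ?_⟩
  filter_upwards [h₀, h₁] with y h₀ h₁
  simp only [inner_sub_left, inner_sub_right] at h₀ h₁
  simp only [inner_sub_right, sub_apply, innerSL_apply_apply]
  linarith

variable [FiniteDimensional ℝ F]

lemma exists_affine_of_affineDirections_eq_top (h : affineDirections ν w = ⊤) :
    ∃ (A : F →L[ℝ] F) (c : F), ∀ᵐ y ∂ν, w y = A y + c := by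
  let b := stdOrthonormalBasis ℝ F
  have hb i : b i ∈ affineDirections ν w := h ▸ Submodule.mem_top
  choose φ c hφ using hb
  refine ⟨∑ i, (φ i).smulRight (b i), ∑ i, c i • b i, ?_⟩
  filter_upwards [ae_all_iff.2 hφ] with y hy
  rw [← b.sum_repr' (w y), sum_apply, ← Finset.sum_add_distrib]
  refine Finset.sum_congr rfl fun i _ => ?_
  rw [real_inner_comm, hy i, add_smul, ContinuousLinearMap.smulRight_apply]

variable [BorelSpace F] {μ : Measure F} [μ.IsAddHaarMeasure]

lemma affineDirections_eq_top [(ae ν).NeBot] (hνμ : ν ≪ μ)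
    (H : ∀ᵐ x ∂ν, ∀ᵐ y ∂ν, inner ℝ (w y - w x) (y - x) = 0) : affineDirections ν w = ⊤ := by
  by_contra hne
  obtain ⟨x₀, hx₀⟩ := H.exists
  have hnull : μ ((· - x₀) ⁻¹' (affineDirections ν w : Set F)) = 0 := by
    rw [(measurePreserving_sub_right μ x₀).measure_preimage
      (Submodule.closed_of_finiteDimensional _).measurableSet.nullMeasurableSet]
    exact Measure.addHaar_submodule μ _ hne
  obtain ⟨x, hx, hx'⟩ := (H.and (hνμ.ae_le (measure_eq_zero_iff_ae_notMem.1 hnull))).exists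
  exact hx' (sub_mem_affineDirections hx₀ hx)

lemma exists_rigidMotion_ae_eq_of_isOpen (hU : IsOpen U) (hne : U.Nonempty)
    (H : ∀ᵐ x ∂μ.restrict U, ∀ᵐ y ∂μ.restrict U, inner ℝ (w y - w x) (y - x) = 0) :
    ∃ q, w =ᵐ[μ.restrict U] rigidMotion q := by
  have : (ae (μ.restrict U)).NeBot := ae_restrict_neBot.2 (hU.measure_pos μ hne).ne'
  obtain ⟨A, c, hA⟩ := exists_affine_of_affineDirections_eq_top
    (affineDirections_eq_top Measure.restrict_le_self.absolutelyContinuous H)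
  obtain ⟨x, hx, hxA⟩ := (H.and hA).exists
  have hzero : (fun y => inner ℝ (A (y - x)) (y - x)) = fun _ => (0 : ℝ) := by
    refine eq_of_ae_eq_restrict_of_analyticOnNhd (μ := μ) ?_ analyticOnNhd_const hU hne ?_
    · have hsub : AnalyticOnNhd ℝ (fun y => y - x) Set.univ :=
        analyticOnNhd_id.sub analyticOnNhd_const
      exact (innerSL ℝ).analyticOnNhd_bilinear _ |>.comp
        ((A.comp_analyticOnNhd hsub).prod hsub) (fun _ _ => Set.mem_univ _)
    · filter_upwards [hx, hA] with y hy hyA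
      rwa [hyA, hxA, add_sub_add_right_eq_sub, ← map_sub] at hy
  exact ⟨(⟨A, fun v => by simpa using congrFun hzero (x + v)⟩, c), hA⟩

theorem exists_rigidMotion_ae_eq (hΩ : IsOpen Ω) (hconn : IsConnected Ω) {ε : ℝ} (hε : 0 < ε)
    (H : ∀ᵐ x ∂μ.restrict Ω, ∀ᵐ y ∂μ.restrict Ω, ‖y - x‖ < ε →
      inner ℝ (w y - w x) (y - x) = 0) :
    ∃ q, w =ᵐ[μ.restrict Ω] rigidMotion q := by
  suffices h : ∃ f ∈ Set.range (rigidMotion (F := F)), w =ᵐ[μ.restrict Ω] f by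
    obtain ⟨_, ⟨q, rfl⟩, hq⟩ := h
    exact ⟨q, hq⟩
  refine exists_ae_eq_of_locally_ae_eq
    (Set.forall_mem_range.2 analyticOnNhd_rigidMotion) hconn fun z hz => ?_
  set U := Ω ∩ Metric.ball z (ε / 2)
  have hU : IsOpen U := hΩ.inter Metric.isOpen_ball
  have hzU : z ∈ U := ⟨hz, Metric.mem_ball_self (half_pos hε)⟩
  obtain ⟨q, hq⟩ := exists_rigidMotion_ae_eq_of_isOpen (μ := μ) (w := w) hU ⟨z, hzU⟩ (by
    filter_upwards [ae_restrict_of_ae_restrict_of_subset Set.inter_subset_left H,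
      ae_restrict_mem hU.measurableSet] with x hx hxU
    filter_upwards [ae_restrict_of_ae_restrict_of_subset Set.inter_subset_left hx,
      ae_restrict_mem hU.measurableSet] with y hy hyU
    refine hy ?_
    rw [← dist_eq_norm]
    linarith [dist_triangle_right y x z, Metric.mem_ball.1 hxU.2, Metric.mem_ball.1 hyU.2])
  exact ⟨U, hU, hzU, _, ⟨q, rfl⟩, hq⟩

end Rigidity

section PairwiseInteraction

variable {α H : Type*} [NormedAddCommGroup H] [InnerProductSpace ℝ H] {Ψ : α → α → H} {w : α → H}

lemma inner_sub_eq_neg_of_antisymm (hΨ : ∀ x y, Ψ y x = -Ψ x y) (q : α × α) :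
    inner ℝ (Ψ q.1 q.2) (w q.2 - w q.1)
      = -(inner ℝ (Ψ q.swap.1 q.swap.2) (w q.swap.1) + inner ℝ (Ψ q.1 q.2) (w q.1)) := by
  rw [Prod.fst_swap, Prod.snd_swap, hΨ q.1 q.2, inner_sub_right, inner_neg_left]
  ring

variable [MeasurableSpace α] {μ : Measure α} [SFinite μ]

lemma integrable_inner_sub_of_antisymm (hΨ : ∀ x y, Ψ y x = -Ψ x y)
    (hint : Integrable (fun q => inner ℝ (Ψ q.1 q.2) (w q.1)) (μ.prod μ)) :
    Integrable (fun q => inner ℝ (Ψ q.1 q.2) (w q.2 - w q.1)) (μ.prod μ) := by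
  simp only [inner_sub_eq_neg_of_antisymm hΨ]
  exact (hint.swap.add hint).neg

/-- Integration by parts for pairwise interactions. -/
lemma two_mul_integral_inner_integral_of_antisymm [CompleteSpace H] (hΨ : ∀ x y, Ψ y x = -Ψ x y)
    (hint : ∀ᵐ x ∂μ, Integrable (Ψ x) μ)
    (hintw : Integrable (fun q => inner ℝ (Ψ q.1 q.2) (w q.1)) (μ.prod μ)) :
    2 * ∫ x, inner ℝ (∫ y, Ψ x y ∂μ) (w x) ∂μ
      = -∫ q, inner ℝ (Ψ q.1 q.2) (w q.2 - w q.1) ∂μ.prod μ := by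
  have hfubini : ∫ x, inner ℝ (∫ y, Ψ x y ∂μ) (w x) ∂μ
      = ∫ q, inner ℝ (Ψ q.1 q.2) (w q.1) ∂μ.prod μ := by
    rw [integral_prod _ hintw]
    refine integral_congr_ae ?_
    filter_upwards [hint] with x hx
    simp only [real_inner_comm (w x), ← integral_inner hx]
  have hswap := integral_prod_swap (μ := μ) (ν := μ) fun q => inner ℝ (Ψ q.1 q.2) (w q.1)
  simp only [inner_sub_eq_neg_of_antisymm hΨ]
  rw [integral_neg, neg_neg, hfubini, two_mul]
  exact (congrArg (· + _) hswap.symm).trans (integral_add hintw.swap hintw).symm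

lemma integral_inner_rigidMotion_eq_zero {F : Type*} [NormedAddCommGroup F]
    [InnerProductSpace ℝ F] [FiniteDimensional ℝ F] [MeasurableSpace F] {μ : Measure F}
    [IsFiniteMeasure μ] {Ψ : F → F → F} (hΨ : ∀ x y, Ψ y x = -Ψ x y)
    (hdir : ∀ x y v, inner ℝ v (y - x) = 0 → inner ℝ (Ψ x y) v = 0)
    (hint : Integrable (fun q => Ψ q.1 q.2) (μ.prod μ)) {q : skew F × F}
    (hq : MemLp (rigidMotion q) ∞ μ) :
    ∫ x, inner ℝ (∫ y, Ψ x y ∂μ) (rigidMotion q x) ∂μ = 0 := by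
  have hintq : Integrable (fun p => inner ℝ (Ψ p.1 p.2) (rigidMotion q p.1)) (μ.prod μ) :=
    memLp_one_iff_integrable.1 <|
      (innerSL ℝ).memLp_of_bilin 1 (memLp_one_iff_integrable.2 hint) (hq.comp_fst μ)
  have h := two_mul_integral_inner_integral_of_antisymm hΨ hint.prod_right_ae hintq
  simpa [hdir _ _ _ (inner_rigidMotion_sub q _ _)] using h

end PairwiseInteraction

section BondInteraction

variable {F : Type*} [NormedAddCommGroup F] [InnerProductSpace ℝ F] [FiniteDimensional ℝ F]
  [MeasurableSpace F] [BorelSpace F] {μ : Measure F} [IsFiniteMeasure μ] {k f : F → ℝ} {w : F → F}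

lemma integrable_prod_mul_fst (hμ : μ ≤ volume) (hk : Integrable k) (hf : Integrable f μ) :
    Integrable (fun q : F × F => k (q.2 - q.1) * f q.1) (μ.prod μ) := by
  have h := hf.convolution_integrand (ContinuousLinearMap.mul ℝ ℝ) hk
  refine (h.mono_measure (Measure.prod_mono hμ le_rfl)).swap.congr
    (Filter.Eventually.of_forall fun q => ?_)
  simp [mul_comm]

lemma integrable_prod_of_norm_le_mul_add {G : Type*} [NormedAddCommGroup G] {Φ : F × F → G}
    (hμ : μ ≤ volume) (hk : Integrable k) (hf : Integrable f μ)
    (hΦ : AEStronglyMeasurable Φ (μ.prod μ))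
    (h : ∀ᵐ q ∂μ.prod μ, ‖Φ q‖ ≤ k (q.2 - q.1) * (f q.1 + f q.2)) : Integrable Φ (μ.prod μ) := by
  have hsnd : Integrable (fun q : F × F => k (q.2 - q.1) * f q.2) (μ.prod μ) := by
    simpa using! (integrable_prod_mul_fst hμ hk.comp_neg hf).swap
  refine ((integrable_prod_mul_fst hμ hk hf).add hsnd).mono' hΦ ?_
  simpa only [mul_add] using! h

lemma memLp_rigidMotion {R : ℝ} (hR : ∀ᵐ x ∂μ, ‖x‖ ≤ R) (q : skew F × F)
    (p : ℝ≥0∞) : MemLp (rigidMotion q) p μ := by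
  refine MemLp.of_bound (C := ‖(q.1 : F →L[ℝ] F)‖ * R + ‖q.2‖)
    (analyticOnNhd_rigidMotion q).continuous.aestronglyMeasurable ?_
  filter_upwards [hR] with x hx
  refine (norm_add_le _ _).trans ?_
  gcongr
  exact (q.1 : F →L[ℝ] F).le_opNorm_of_le hx

variable {B : F → F → F →L[ℝ] F}

lemma integrable_pairwise_apply_sub (hμ : μ ≤ volume) (hk : Integrable k)
    (hBm : AEStronglyMeasurable (fun q : F × F => B q.1 q.2) (μ.prod μ))
    (hBk : ∀ x y, ‖B x y‖ ≤ k (y - x)) (hw : Integrable w μ) :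
    Integrable (fun q : F × F => B q.1 q.2 (w q.2 - w q.1)) (μ.prod μ) := by
  refine integrable_prod_of_norm_le_mul_add hμ hk hw.norm
    (isBoundedBilinearMap_apply.continuous.comp_aestronglyMeasurable
      (hBm.prodMk (hw.1.comp_snd.sub hw.1.comp_fst))) (.of_forall fun q => ?_)
  refine (B q.1 q.2).le_of_opNorm_le_of_le (hBk _ _) ?_
  rw [add_comm]
  exact norm_sub_le _ _

lemma integrable_inner_pairwise_apply_sub (hμ : μ ≤ volume) (hk : Integrable k)
    (hBm : AEStronglyMeasurable (fun q : F × F => B q.1 q.2) (μ.prod μ))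
    (hBk : ∀ x y, ‖B x y‖ ≤ k (y - x)) (hw : MemLp w 2 μ) :
    Integrable (fun q : F × F => inner ℝ (B q.1 q.2 (w q.2 - w q.1)) (w q.1)) (μ.prod μ) := by
  have hw' := hw.integrable one_le_two
  refine integrable_prod_of_norm_le_mul_add hμ hk
    ((hw.integrable_norm_pow two_ne_zero).const_mul 2)
    ((integrable_pairwise_apply_sub hμ hk hBm hBk hw').1.inner hw'.1.comp_fst)
    (.of_forall fun q => ?_)
  have hB : ‖B q.1 q.2 (w q.2 - w q.1)‖ ≤ k (q.2 - q.1) * (‖w q.2‖ + ‖w q.1‖) :=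
    (B q.1 q.2).le_of_opNorm_le_of_le (hBk _ _) (norm_sub_le _ _)
  have hk0 : 0 ≤ k (q.2 - q.1) := (norm_nonneg _).trans (hBk _ _)
  calc ‖inner ℝ (B q.1 q.2 (w q.2 - w q.1)) (w q.1)‖
      ≤ k (q.2 - q.1) * (‖w q.2‖ + ‖w q.1‖) * ‖w q.1‖ :=
        (norm_inner_le_norm _ _).trans (by gcongr)
    _ = k (q.2 - q.1) * ((‖w q.2‖ + ‖w q.1‖) * ‖w q.1‖) := mul_assoc _ _ _
    _ ≤ k (q.2 - q.1) * (2 * ‖w q.1‖ ^ 2 + 2 * ‖w q.2‖ ^ 2) := by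
        gcongr
        nlinarith [sq_nonneg (‖w q.2‖ - ‖w q.1‖), sq_nonneg ‖w q.1‖, sq_nonneg ‖w q.2‖]

lemma ae_inner_pairwise_eq_zero (hμ : μ ≤ volume) (hk : Integrable k)
    (hBm : AEStronglyMeasurable (fun q : F × F => B q.1 q.2) (μ.prod μ))
    (hBk : ∀ x y, ‖B x y‖ ≤ k (y - x)) (hBsymm : ∀ x y, B y x = B x y)
    (hBnonneg : ∀ᵐ q ∂μ.prod μ, ∀ v, 0 ≤ inner ℝ (B q.1 q.2 v) v) (hw : MemLp w 2 μ)
    (heq : ∀ᵐ x ∂μ, ∫ y, B x y (w y - w x) ∂μ = 0) :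
    ∀ᵐ q ∂μ.prod μ, inner ℝ (B q.1 q.2 (w q.2 - w q.1)) (w q.2 - w q.1) = 0 := by
  have hanti x y : B y x (w x - w y) = -B x y (w y - w x) := by
    rw [hBsymm x y, ← map_neg, neg_sub]
  have hintw := integrable_inner_pairwise_apply_sub hμ hk hBm hBk hw
  have henergy := two_mul_integral_inner_integral_of_antisymm hanti
    (integrable_pairwise_apply_sub hμ hk hBm hBk (hw.integrable one_le_two)).prod_right_ae hintw
  have hzero : ∫ x, inner ℝ (∫ y, B x y (w y - w x) ∂μ) (w x) ∂μ = 0 :=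
    integral_eq_zero_of_ae <| heq.mono fun x hx => by simp only [hx, inner_zero_left, Pi.zero_apply]
  rw [hzero, mul_zero, zero_eq_neg] at henergy
  exact (integral_eq_zero_iff_of_nonneg_ae (hBnonneg.mono fun q hq => hq _)
    (integrable_inner_sub_of_antisymm hanti hintw)).1 henergy

end BondInteraction

section BondField

variable {F : Type*} [NormedAddCommGroup F] [InnerProductSpace ℝ F]

/-- The tensors `k(y - x) h(s) e ⊗ e` of the bonds of the displacement `u`, with `e = e_{y-x}` and
`s = √|y - x| S(y, x, u)`. -/
def bondField (k : F → ℝ) (h : ℝ → ℝ) (u : F → F) (x y : F) : F →L[ℝ] F :=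
  bondTensor k h (y - x) (u y - u x)

/-- The scaled strains of all bonds of `u` in `Ω` with horizon `ε`. -/
def bondStretches (Ω : Set F) (ε : ℝ) (u : F → F) : Set ℝ :=
  {s | ∃ x ∈ Ω, ∃ y ∈ Ω, y ≠ x ∧ ‖y - x‖ < ε ∧ s = stretch (y - x) (u y - u x)}

variable {ε C : ℝ} {k : F → ℝ} {h : ℝ → ℝ} {Ω : Set F} {u w : F → F}

lemma norm_bondField_le (hh : ∀ r, |h r| ≤ C) (x y : F) :
    ‖bondField k h u x y‖ ≤ C * ‖k (y - x)‖ :=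
  norm_bondTensor_le hh _ _

end BondField

section BondKernel

/-- Radial bond weights `k(y - x)` with horizon `ε`. The integrability against `1 / √|z|` is what
makes the force differentiable: a relative displacement `p` strains the bond `z` by at most
`|p| / √|z|`. -/
structure IsBondKernel {F : Type*} [NormedAddCommGroup F] [InnerProductSpace ℝ F]
    [FiniteDimensional ℝ F] [MeasurableSpace F] [BorelSpace F] (ε : ℝ) (k : F → ℝ) : Prop where
  measurable : Measurable k
  nonneg : ∀ z, 0 ≤ k z
  pos_iff : ∀ z, 0 < k z ↔ z ≠ 0 ∧ ‖z‖ < ε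
  radial : ∀ z z', ‖z‖ = ‖z'‖ → k z = k z'
  integrable_inv_sqrt_mul : Integrable fun z => (√‖z‖)⁻¹ * k z

variable {F : Type*} [NormedAddCommGroup F] [InnerProductSpace ℝ F] [FiniteDimensional ℝ F]
  [MeasurableSpace F] [BorelSpace F]
  {ε C m : ℝ} {k : F → ℝ} {h : ℝ → ℝ} {Ω : Set F} {u w : F → F}

namespace IsBondKernel

lemma even (hk : IsBondKernel ε k) (z : F) : k (-z) = k z :=
  hk.radial _ _ (norm_neg z)

lemma le_sqrt_mul (hk : IsBondKernel ε k) (z : F) : k z ≤ √ε * ((√‖z‖)⁻¹ * k z) := by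
  rcases (hk.nonneg z).eq_or_lt with h0 | hpos
  · simp [← h0]
  obtain ⟨hz, hlt⟩ := (hk.pos_iff z).1 hpos
  have := Real.sqrt_pos.2 (norm_pos_iff.2 hz)
  calc k z = √‖z‖ * ((√‖z‖)⁻¹ * k z) := by field_simp
    _ ≤ √ε * ((√‖z‖)⁻¹ * k z) := by gcongr

lemma integrable (hk : IsBondKernel ε k) : Integrable k :=
  (hk.integrable_inv_sqrt_mul.const_mul √ε).mono' hk.measurable.aestronglyMeasurable <|
    .of_forall fun z => (Real.norm_of_nonneg (hk.nonneg z)).trans_le (hk.le_sqrt_mul z)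

lemma bondField_comm (hk : IsBondKernel ε k) (x y : F) :
    bondField k h u y x = bondField k h u x y := by
  rw [bondField, bondField, ← bondTensor_neg_neg hk.even, neg_sub, neg_sub]

lemma mul_le_inner_bondField_self (hk : IsBondKernel ε k)
    (hm : ∀ s ∈ bondStretches Ω ε u, m ≤ h s) {x y : F} (hx : x ∈ Ω) (hy : y ∈ Ω) (v : F) :
    m * (k (y - x) * inner ℝ (dir (y - x)) v ^ 2) ≤ inner ℝ (bondField k h u x y v) v := by
  rw [bondField, inner_bondTensor_apply, ← pow_two, ← mul_assoc, mul_comm m]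
  rcases (hk.nonneg (y - x)).eq_or_lt with h0 | hpos
  · simp [← h0]
  obtain ⟨hne, hlt⟩ := (hk.pos_iff _).1 hpos
  have := hm _ ⟨x, hx, y, hy, sub_ne_zero.1 hne, hlt, rfl⟩
  gcongr

lemma inner_sub_eq_zero_of_inner_bondField_self_eq_zero (hk : IsBondKernel ε k)
    (hh : ∀ s ∈ bondStretches Ω ε u, 0 < h s) {x y v : F} (hx : x ∈ Ω) (hy : y ∈ Ω)
    (hlt : ‖y - x‖ < ε) (hv : inner ℝ (bondField k h u x y v) v = 0) :
    inner ℝ v (y - x) = 0 := by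
  rcases eq_or_ne y x with rfl | hne
  · simp
  have hkpos := (hk.pos_iff _).2 ⟨sub_ne_zero.2 hne, hlt⟩
  have hhpos := hh _ ⟨x, hx, y, hy, hne, hlt, rfl⟩
  rw [bondField, inner_bondTensor_apply, mul_eq_zero_iff_left (by positivity),
    mul_self_eq_zero] at hv
  rw [real_inner_comm, ← inner_dir_mul_norm, hv, zero_mul]

lemma integrable_bondTensor_sub {μ : Measure F} (hk : IsBondKernel ε k) (hμ : μ ≤ volume)
    (hhm : Measurable h) (hhC : ∀ r, |h r| ≤ C) (hu : AEStronglyMeasurable u μ) (ξ p : F) :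
    Integrable (fun y => bondTensor k h (y - ξ) (u y - p)) μ := by
  have hmeas : AEMeasurable (fun y => (y - ξ, u y - p)) μ :=
    (measurable_id.sub_const ξ).aemeasurable.prodMk (hu.aemeasurable.sub_const p)
  exact (((hk.integrable.norm.comp_sub_right ξ).const_mul C).mono_measure hμ).mono'
    ((measurable_bondTensor hk.measurable hhm).comp_aemeasurable hmeas).aestronglyMeasurable
    (.of_forall fun y => norm_bondTensor_le hhC _ _)

lemma integrable_bondField {μ : Measure F} (hk : IsBondKernel ε k) (hμ : μ ≤ volume)
    (hhm : Measurable h) (hhC : ∀ r, |h r| ≤ C) (hu : AEStronglyMeasurable u μ) (x : F) :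
    Integrable (bondField k h u x) μ :=
  hk.integrable_bondTensor_sub hμ hhm hhC hu x (u x)

end IsBondKernel

lemma aestronglyMeasurable_bondField (hk : Measurable k) (hh : Measurable h) {μ : Measure F}
    [SFinite μ] (hu : AEStronglyMeasurable u μ) :
    AEStronglyMeasurable (fun q : F × F => bondField k h u q.1 q.2) (μ.prod μ) :=
  ((measurable_bondTensor hk hh).comp_aemeasurable ((measurable_snd.sub measurable_fst).aemeasurable
    |>.prodMk (hu.comp_snd.sub hu.comp_fst).aemeasurable)).aestronglyMeasurable

/-- An equilibrium stores no energy, so no bond is strained and the displacement is rigid. -/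
theorem IsBondKernel.ae_eq_zero_of_equilibrium
    (hk : IsBondKernel ε k) (hΩ : IsOpen Ω) (hconn : IsConnected Ω) (hε : 0 < ε)
    [IsFiniteMeasure (volume.restrict Ω)]
    (hhm : Measurable h) (hhC : ∀ r, |h r| ≤ C) (hhpos : ∀ s ∈ bondStretches Ω ε u, 0 < h s)
    (hu : AEStronglyMeasurable u (volume.restrict Ω)) (hw : MemLp w 2 (volume.restrict Ω))
    (horth : ∀ q : skew F × F, ∫ x in Ω, inner ℝ (w x) (rigidMotion q x) = 0)
    (heq : ∀ᵐ x ∂volume.restrict Ω, ∫ y in Ω, bondField k h u x y (w y - w x) = 0) :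
    w =ᵐ[volume.restrict Ω] 0 := by
  have hmem : ∀ᵐ x ∂volume.restrict Ω, x ∈ Ω := ae_restrict_mem hΩ.measurableSet
  have henergy : ∀ᵐ q ∂(volume.restrict Ω).prod (volume.restrict Ω),
      inner ℝ (bondField k h u q.1 q.2 (w q.2 - w q.1)) (w q.2 - w q.1) = 0 := by
    refine ae_inner_pairwise_eq_zero Measure.restrict_le_self
      (hk.integrable.norm.const_mul C) (aestronglyMeasurable_bondField hk.measurable hhm hu)
      (fun _ _ => norm_bondField_le hhC _ _) hk.bondField_comm ?_ hw heq
    filter_upwards [Measure.quasiMeasurePreserving_fst.ae hmem,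
      Measure.quasiMeasurePreserving_snd.ae hmem] with q hx hy v
    simpa using hk.mul_le_inner_bondField_self (fun s hs => (hhpos s hs).le) hx hy v
  have hstrain : ∀ᵐ x ∂volume.restrict Ω, ∀ᵐ y ∂volume.restrict Ω,
      ‖y - x‖ < ε → inner ℝ (w y - w x) (y - x) = 0 := by
    filter_upwards [hmem, Measure.ae_ae_of_ae_prod henergy] with x hx hxe
    filter_upwards [hmem, hxe] with y hy hye hlt
    exact hk.inner_sub_eq_zero_of_inner_bondField_self_eq_zero hhpos hx hy hlt hye
  obtain ⟨q, hq⟩ := exists_rigidMotion_ae_eq hΩ hconn hε hstrain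
  have hsq : ∫ x in Ω, ‖w x‖ ^ 2 = 0 := by
    rw [← horth q]
    refine integral_congr_ae (hq.mono fun x hx => ?_)
    simp only [← hx, real_inner_self_eq_norm_sq]
  refine ((integral_eq_zero_iff_of_nonneg (fun x => by positivity)
    (hw.integrable_norm_pow two_ne_zero)).1 hsq).mono fun x hx => ?_
  simpa using hx

end BondKernel

section Coercivity

variable {F : Type*} [NormedAddCommGroup F] [InnerProductSpace ℝ F]

lemma exists_linearIsometryEquiv_apply_eq {a b : F} (hab : ‖a‖ = ‖b‖) :
    ∃ R : F ≃ₗᵢ[ℝ] F, R a = b :=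
  ⟨_, Submodule.reflection_sub hab⟩

variable [FiniteDimensional ℝ F]

lemma exists_pos_mul_sq_le_inner {A : F →L[ℝ] F} (hA : ∀ v ≠ 0, 0 < inner ℝ (A v) v) :
    ∃ δ > 0, ∀ v, δ * ‖v‖ ^ 2 ≤ inner ℝ (A v) v := by
  obtain ⟨δ, hδ, hle⟩ := (isCompact_sphere (0 : F) 1).exists_forall_le' (a := 0)
    (f := fun v => inner ℝ (A v) v) (by fun_prop)
    fun v hv => hA v (ne_zero_of_mem_unit_sphere ⟨v, hv⟩)
  refine ⟨δ, hδ, fun v => ?_⟩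
  rcases eq_or_ne v 0 with rfl | hv
  · simp
  have hdir := hle (dir v) (by simp [dir, norm_smul, hv])
  calc δ * ‖v‖ ^ 2 ≤ inner ℝ (A (dir v)) (dir v) * ‖v‖ ^ 2 := by gcongr
    _ = inner ℝ (A (‖v‖ • dir v)) (‖v‖ • dir v) := by
        rw [map_smul, real_inner_smul_left, real_inner_smul_right]
        ring
    _ = inner ℝ (A v) v := by rw [norm_smul_dir]

lemma inner_integral_clm_apply {α : Type*} [MeasurableSpace α] {μ : Measure α} {A : α → F →L[ℝ] F}
    (hA : Integrable A μ) (v w : F) : inner ℝ ((∫ y, A y ∂μ) v) w = ∫ y, inner ℝ (A y v) w ∂μ := by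
  simp only [ContinuousLinearMap.integral_apply hA, real_inner_comm w,
    ← integral_inner (hA.apply_continuousLinearMap v)]

variable [MeasurableSpace F] [BorelSpace F] {ε C m s ρ : ℝ} {k : F → ℝ} {h : ℝ → ℝ} {Ω : Set F}
  {u : F → F}

namespace IsBondKernel

lemma integrable_mul_inner_dir_sq (hk : IsBondKernel ε k) (v : F) :
    Integrable fun z => k z * inner ℝ (dir z) v ^ 2 := by
  have hdir := measurable_dir (F := F)
  refine hk.integrable.mul_bdd (c := ‖v‖ ^ 2) (by fun_prop) (.of_forall fun z => ?_)
  rw [norm_pow]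
  gcongr
  exact (norm_inner_le_norm _ _).trans (mul_le_of_le_one_left (norm_nonneg _) (norm_dir_le z))

lemma setIntegral_mul_inner_dir_sq_pos (hk : IsBondKernel ε k) {e v : F} (he : ‖e‖ < ε)
    (hρ : 0 < ρ) (hv : v ≠ 0) : 0 < ∫ z in Metric.ball e ρ, k z * inner ℝ (dir z) v ^ 2 := by
  have hplane : volume ((ℝ ∙ v)ᗮ : Set F) = 0 :=
    Measure.addHaar_submodule _ _ fun htop => hv <| inner_self_eq_zero.1 <|
      Submodule.mem_orthogonal_singleton_iff_inner_right.1 (Submodule.eq_top_iff'.1 htop v)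
  have hsub : (Metric.ball e ρ ∩ Metric.ball 0 ε) \ (ℝ ∙ v)ᗮ ⊆
      (Function.support fun z => k z * inner ℝ (dir z) v ^ 2) ∩ Metric.ball e ρ := by
    rintro z ⟨⟨hzρ, hzε⟩, hzv⟩
    refine ⟨?_, hzρ⟩
    have hz : z ≠ 0 := fun h0 => hzv (h0 ▸ zero_mem _)
    have hkz := (hk.pos_iff z).2 ⟨hz, mem_ball_zero_iff.1 hzε⟩
    refine mul_ne_zero hkz.ne' (pow_ne_zero 2 fun h0 => hzv ?_)
    refine Submodule.mem_orthogonal_singleton_iff_inner_left.2 ?_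
    rw [← inner_dir_mul_norm, h0, zero_mul]
  rw [setIntegral_pos_iff_support_of_nonneg_ae
    (.of_forall fun z => mul_nonneg (hk.nonneg z) (sq_nonneg _))
    (hk.integrable_mul_inner_dir_sq v).integrableOn]
  refine lt_of_lt_of_le ?_ (measure_mono hsub)
  rw [measure_sdiff_null hplane]
  exact (Metric.isOpen_ball.inter Metric.isOpen_ball).measure_pos _
    ⟨e, Metric.mem_ball_self hρ, mem_ball_zero_iff.2 he⟩

lemma setIntegral_mul_inner_dir_sq_map (hk : IsBondKernel ε k) (R : F ≃ₗᵢ[ℝ] F) (e v : F) :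
    ∫ z in Metric.ball (R e) ρ, k z * inner ℝ (dir z) (R v) ^ 2
      = ∫ z in Metric.ball e ρ, k z * inner ℝ (dir z) v ^ 2 := by
  have hdir z : dir (R z) = R (dir z) := by simp [dir]
  rw [← R.measurePreserving.setIntegral_preimage_emb R.toHomeomorph.measurableEmbedding,
    R.preimage_ball, R.symm_apply_apply]
  simp only [hdir, R.inner_map_map, hk.radial _ _ (R.norm_map _)]

lemma exists_pos_mul_sq_le_setIntegral_ball (hk : IsBondKernel ε k) (hs : s < ε) (hρ : 0 < ρ) :
    ∃ δ > 0, ∀ e v : F, ‖e‖ = s →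
      δ * ‖v‖ ^ 2 ≤ ∫ z in Metric.ball e ρ, k z * inner ℝ (dir z) v ^ 2 := by
  by_cases hne : ∃ e₀ : F, ‖e₀‖ = s
  swap
  · exact ⟨1, one_pos, fun e _ he => absurd ⟨e, he⟩ hne⟩
  obtain ⟨e₀, he₀⟩ := hne
  have hint : Integrable (fun z => bondTensor k 1 z 0) (volume.restrict (Metric.ball e₀ ρ)) := by
    simpa using hk.integrable_bondTensor_sub (C := 1) Measure.restrict_le_self measurable_one
      (fun r => by simp) (u := 0) aestronglyMeasurable_const 0 0
  have hquad v : inner ℝ ((∫ z in Metric.ball e₀ ρ, bondTensor k 1 z 0) v) v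
      = ∫ z in Metric.ball e₀ ρ, k z * inner ℝ (dir z) v ^ 2 := by
    simp only [inner_integral_clm_apply hint, inner_bondTensor_apply, Pi.one_apply, mul_one,
      pow_two]
  obtain ⟨δ, hδ, hle⟩ := exists_pos_mul_sq_le_inner fun v hv =>
    (hk.setIntegral_mul_inner_dir_sq_pos (he₀.trans_lt hs) hρ hv).trans_eq (hquad v).symm
  refine ⟨δ, hδ, fun e v he => ?_⟩
  -- The kernel is radial, so the bound for the ball around `e₀` carries over to all its rotations.
  obtain ⟨R, rfl⟩ := exists_linearIsometryEquiv_apply_eq (he₀.trans he.symm)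
  have := hle (R.symm v)
  rwa [hquad, R.symm.norm_map, ← hk.setIntegral_mul_inner_dir_sq_map R, R.apply_symm_apply] at this

lemma setIntegral_ball_le_inner_integral_bondField (hk : IsBondKernel ε k)
    (hΩ : MeasurableSet Ω) (hhm : Measurable h) (hhC : ∀ r, |h r| ≤ C) (hm0 : 0 ≤ m)
    (hm : ∀ s ∈ bondStretches Ω ε u, m ≤ h s) (hu : AEStronglyMeasurable u (volume.restrict Ω))
    {x e : F} (hx : x ∈ Ω) (hball : Metric.ball (x + e) ρ ⊆ Ω) (v : F) :
    m * ∫ z in Metric.ball e ρ, k z * inner ℝ (dir z) v ^ 2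
      ≤ inner ℝ ((∫ y in Ω, bondField k h u x y) v) v := by
  have hint := hk.integrable_bondField Measure.restrict_le_self hhm hhC hu x
  have hshift : ∫ y in Metric.ball (x + e) ρ, k (y - x) * inner ℝ (dir (y - x)) v ^ 2
      = ∫ z in Metric.ball e ρ, k z * inner ℝ (dir z) v ^ 2 := by
    rw [← (measurePreserving_sub_right volume x).setIntegral_preimage_emb
      (MeasurableEquiv.subRight x).measurableEmbedding _ (Metric.ball e ρ)]
    congr 3
    ext y
    simp [dist_eq_norm, sub_sub]
  have hint' := ((hk.integrable_mul_inner_dir_sq v).comp_sub_right x).integrableOn (s := Ω)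
  rw [inner_integral_clm_apply hint, ← hshift]
  calc m * ∫ y in Metric.ball (x + e) ρ, k (y - x) * inner ℝ (dir (y - x)) v ^ 2
      ≤ m * ∫ y in Ω, k (y - x) * inner ℝ (dir (y - x)) v ^ 2 :=
        mul_le_mul_of_nonneg_left (setIntegral_mono_set hint'
          (.of_forall fun y => mul_nonneg (hk.nonneg _) (sq_nonneg _)) hball.eventuallyLE) hm0
    _ = ∫ y in Ω, m * (k (y - x) * inner ℝ (dir (y - x)) v ^ 2) := (integral_const_mul _ _).symm
    _ ≤ ∫ y in Ω, inner ℝ (bondField k h u x y v) v :=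
        setIntegral_mono_on (hint'.const_mul m)
          ((hint.apply_continuousLinearMap v).inner_const v) hΩ fun y hy =>
          hk.mul_le_inner_bondField_self hm hx hy v

theorem exists_pos_mul_sq_le_inner_integral_bondField (hk : IsBondKernel ε k)
    (hΩ : MeasurableSet Ω) (hs : s < ε) (hρ : 0 < ρ)
    (hball : ∀ x ∈ Ω, ∃ e, ‖e‖ = s ∧ Metric.ball (x + e) ρ ⊆ Ω)
    (hhm : Measurable h) (hhC : ∀ r, |h r| ≤ C) (hm0 : 0 < m)
    (hm : ∀ s ∈ bondStretches Ω ε u, m ≤ h s) (hu : AEStronglyMeasurable u (volume.restrict Ω)) :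
    ∃ γ > 0, ∀ x ∈ Ω, ∀ v, γ * ‖v‖ ^ 2 ≤ inner ℝ ((∫ y in Ω, bondField k h u x y) v) v := by
  obtain ⟨δ, hδ, hle⟩ := hk.exists_pos_mul_sq_le_setIntegral_ball hs hρ
  refine ⟨m * δ, by positivity, fun x hx v => ?_⟩
  obtain ⟨e, he, hsub⟩ := hball x hx
  rw [mul_assoc]
  exact (mul_le_mul_of_nonneg_left (hle e v he) hm0.le).trans <|
    hk.setIntegral_ball_le_inner_integral_bondField hΩ hhm hhC hm0.le hm hu hx hsub v

end IsBondKernel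

end Coercivity

section ContinuousFamily

open Filter Topology

lemma tendsto_eLpNorm_smul_sub {Q α G : Type*} [TopologicalSpace Q] [FirstCountableTopology Q]
    [MeasurableSpace α] {μ : Measure α} [NormedAddCommGroup G] [NormedSpace ℝ G] {f : Q → α → ℝ}
    {Φ : Q → α → G} {q₀ : Q} {C : ℝ} (hf : ∀ q, MemLp (f q) 1 μ)
    (hfq₀ : Tendsto (fun q => eLpNorm (f q - f q₀) 1 μ) (𝓝 q₀) (𝓝 0))
    (hΦ : ∀ q, AEStronglyMeasurable (Φ q) μ) (hC : ∀ q y, ‖Φ q y‖ ≤ C)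
    (hΦq₀ : ∀ y, f q₀ y ≠ 0 → ContinuousAt (Φ · y) q₀) :
    Tendsto (fun q => eLpNorm (f q • Φ q - f q₀ • Φ q₀) 1 μ) (𝓝 q₀) (𝓝 0) := by
  have hmul (f' : α → ℝ) (Φ' : α → G) {C' : ℝ} (hC' : ∀ y, ‖Φ' y‖ ≤ C') (y : α) :
      ‖(f' • Φ') y‖ₑ ≤ ‖C' * f' y‖ₑ := by
    rw [enorm_le_iff_norm_le, Pi.smul_apply', norm_smul, norm_mul, mul_comm,
      Real.norm_of_nonneg ((norm_nonneg _).trans (hC' y))]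
    exact mul_le_mul_of_nonneg_right (hC' y) (norm_nonneg _)
  have hdom : Tendsto (fun q => eLpNorm (f q₀ • (Φ q - Φ q₀)) 1 μ) (𝓝 q₀) (𝓝 0) := by
    simp only [eLpNorm_one_eq_lintegral_enorm]
    rw [← lintegral_zero (μ := μ)]
    refine tendsto_lintegral_filter_of_dominated_convergence' (fun y => ‖(C + C) * f q₀ y‖ₑ)
      (.of_forall fun q => ((hf q₀).1.smul ((hΦ q).sub (hΦ q₀))).enorm)
      (.of_forall fun q => .of_forall <| hmul _ _ fun y =>
        (norm_sub_le _ _).trans (add_le_add (hC q y) (hC q₀ y)))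
      ((memLp_one_iff_integrable.1 (hf q₀)).const_mul _).2.ne (.of_forall fun y => ?_)
    by_cases hy : f q₀ y = 0
    · simp [hy]
    · have h0 : Tendsto (fun q => f q₀ y • (Φ q y - Φ q₀ y)) (𝓝 q₀) (𝓝 0) := by
        simpa using ((hΦq₀ y hy).tendsto.sub_const (Φ q₀ y)).const_smul (f q₀ y)
      simpa using h0.enorm
  have hsplit q : f q • Φ q - f q₀ • Φ q₀ = (f q - f q₀) • Φ q + f q₀ • (Φ q - Φ q₀) := by
    rw [sub_smul, smul_sub, sub_add_sub_cancel]
  have hbound q : eLpNorm ((f q - f q₀) • Φ q) 1 μ ≤ ‖C‖ₑ * eLpNorm (f q - f q₀) 1 μ := by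
    rw [← eLpNorm_const_smul]
    exact eLpNorm_mono_enorm (hmul _ _ (hC q))
  have hlim := (ENNReal.Tendsto.const_mul (a := ‖C‖ₑ) hfq₀ (.inr enorm_ne_top)).add hdom
  rw [mul_zero, add_zero] at hlim
  refine tendsto_of_tendsto_of_tendsto_of_le_of_le tendsto_const_nhds hlim (fun _ => zero_le)
    fun q => ?_
  simp only [hsplit q]
  exact (eLpNorm_add_le (((hf q).1.sub (hf q₀).1).smul (hΦ q))
    ((hf q₀).1.smul ((hΦ q).sub (hΦ q₀))) le_rfl).trans (add_le_add (hbound q) le_rfl)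

variable {F : Type*} [NormedAddCommGroup F] [InnerProductSpace ℝ F] {h : ℝ → ℝ} {u : F → F}

lemma continuousAt_bondTensor_one_sub (hh : Continuous h) {y : F} {q₀ : F × F} (hy : y ≠ q₀.1) :
    ContinuousAt (fun q : F × F => bondTensor 1 h (y - q.1) (u y - q.2)) q₀ := by
  have hz : y - q₀.1 ≠ 0 := sub_ne_zero.2 hy
  have hs : ContinuousAt (fun q : F × F => stretch (y - q.1) (u y - q.2)) q₀ :=
    (continuousAt_stretch hz).comp (f := fun q : F × F => (y - q.1, u y - q.2)) (by fun_prop)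
  have hd : ContinuousAt (fun q : F × F => dir (y - q.1)) q₀ :=
    (continuousAt_dir hz).comp (f := fun q : F × F => y - q.1) (by fun_prop)
  exact (continuousAt_const.mul (hh.continuousAt.comp hs)).smul
    (continuous_dyad.continuousAt.comp hd)

variable [FiniteDimensional ℝ F] [MeasurableSpace F] [BorelSpace F]

lemma tendsto_eLpNorm_comp_sub_right {f : F → ℝ} (hf : MemLp f 1) (x₀ : F) :
    Tendsto (fun x => eLpNorm ((fun y => f (y - x)) - fun y => f (y - x₀)) 1) (𝓝 x₀) (𝓝 0) := by
  let τ : F → C(F, F) := fun x => ⟨fun y => y - x, by fun_prop⟩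
  have hτ : Continuous τ := ContinuousMap.continuous_of_continuous_uncurry _ <|
    continuous_snd.sub continuous_fst
  have hmp x : MeasurePreserving (τ x) := measurePreserving_sub_right volume x
  have h := ((continuous_const (y := hf.toLp f)).compMeasurePreservingLp hτ hmp
    ENNReal.one_ne_top).tendsto x₀
  simp only [Lp.toLp_compMeasurePreserving] at h
  exact (Lp.tendsto_Lp_iff_tendsto_eLpNorm'' _ _ _ _).1 h

variable {ε C : ℝ} {k : F → ℝ} {μ : Measure F}

namespace IsBondKernel

/-- The bond tensors `y ↦ k(y - ξ) h(s) e ⊗ e` at the point `ξ` with displacement `p`, as a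
function of `(ξ, p)` with values in `L¹`. -/
def bondFamily (hk : IsBondKernel ε k) (hμ : μ ≤ volume) (hh : Continuous h)
    (hhC : ∀ r, |h r| ≤ C) (hu : AEStronglyMeasurable u μ) (q : F × F) : Lp (F →L[ℝ] F) 1 μ :=
  (memLp_one_iff_integrable.2
    (hk.integrable_bondTensor_sub hμ hh.measurable hhC hu q.1 q.2)).toLp _

lemma continuous_bondFamily (hk : IsBondKernel ε k) (hμ : μ ≤ volume) (hh : Continuous h)
    (hhC : ∀ r, |h r| ≤ C) (hu : AEStronglyMeasurable u μ) :
    Continuous (hk.bondFamily hμ hh hhC hu) := by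
  refine continuous_iff_continuousAt.2 fun q₀ => (Lp.tendsto_Lp_iff_tendsto_eLpNorm'' _ _ _ _).2 ?_
  have hk1 (q : F × F) : MemLp (fun y => k (y - q.1)) 1 := 
    memLp_one_iff_integrable.2 (hk.integrable.comp_sub_right q.1)
  have htrans : Tendsto (fun q : F × F =>
      eLpNorm ((fun y => k (y - q.1)) - fun y => k (y - q₀.1)) 1 μ) (𝓝 q₀) (𝓝 0) :=
    tendsto_of_tendsto_of_tendsto_of_le_of_le tendsto_const_nhds
      ((tendsto_eLpNorm_comp_sub_right (memLp_one_iff_integrable.2 hk.integrable) q₀.1).comp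
        continuousAt_fst) (fun _ => zero_le) fun q => eLpNorm_mono_measure _ hμ
  have hsmul (q : F × F) : (fun y => bondTensor k h (y - q.1) (u y - q.2))
      = (fun y => k (y - q.1)) • fun y => bondTensor 1 h (y - q.1) (u y - q.2) := by
    ext y : 1
    simp [bondTensor, smul_smul]
  simp only [hsmul]
  refine tendsto_eLpNorm_smul_sub (C := C) (fun q => (hk1 q).mono_measure hμ) htrans
    (fun q => ?_) (fun q y => ?_) fun y hy => continuousAt_bondTensor_one_sub hh ?_
  · exact ((measurable_bondTensor measurable_one hh.measurable).comp_aemeasurable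
      ((measurable_id.sub_const q.1).aemeasurable.prodMk
        (hu.aemeasurable.sub_const q.2))).aestronglyMeasurable
  · simpa using norm_bondTensor_le (k := 1) hhC (y - q.1) (u y - q.2)
  · exact sub_ne_zero.1 ((hk.pos_iff _).1 ((hk.nonneg _).lt_of_ne' hy)).1

end IsBondKernel

end ContinuousFamily

section RigidMoments

variable {F : Type*} [NormedAddCommGroup F] [InnerProductSpace ℝ F] [FiniteDimensional ℝ F]
  [MeasurableSpace F] [BorelSpace F] {μ : Measure F} [IsFiniteMeasure μ] {R : ℝ}

/-- Rigid motions as elements of `L¹` of a measure with bounded support. -/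
def rigidMotionLp (hR : ∀ᵐ x ∂μ, ‖x‖ ≤ R) : skew F × F →L[ℝ] Lp F 1 μ :=
  LinearMap.toContinuousLinearMap
    { toFun := fun q => (memLp_rigidMotion hR q 1).toLp
      map_add' := fun q q' => by
        rw [← MemLp.toLp_add]
        congr 1 with x
        simp only [rigidMotion, Prod.fst_add, Prod.snd_add, Submodule.coe_add, add_apply,
          Pi.add_apply]
        abel
      map_smul' := fun c q => by
        rw [RingHom.id_apply, ← MemLp.toLp_const_smul]
        congr 1 with x
        simp [rigidMotion] }

/-- The bounded fields orthogonal to the rigid motions. -/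
def rigidOrthogonal (μ : Measure F) : Set (Lp F ∞ μ) :=
  {w | ∀ q : skew F × F, ∫ x, inner ℝ (w x) (rigidMotion q x) ∂μ = 0}

/-- The moments `q ↦ ∫ w · q` of a bounded field against rigid motions. -/
def rigidMoments (hR : ∀ᵐ x ∂μ, ‖x‖ ≤ R) : Lp F ∞ μ →L[ℝ] skew F × F →L[ℝ] ℝ :=
  ContinuousLinearMap.precomp ℝ (rigidMotionLp hR) ∘L (innerSL ℝ).lpPairing μ ∞ 1

lemma rigidMoments_apply (hR : ∀ᵐ x ∂μ, ‖x‖ ≤ R) (w : Lp F ∞ μ) (q : skew F × F) :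
    rigidMoments hR w q = ∫ x, inner ℝ (w x) (rigidMotion q x) ∂μ := by
  refine (ContinuousLinearMap.lpPairing_eq_integral _ _ _).trans (integral_congr_ae ?_)
  filter_upwards [(memLp_rigidMotion hR q 1).coeFn_toLp] with x hx
  exact congrArg _ hx

lemma rigidMoments_eq_zero_iff (hR : ∀ᵐ x ∂μ, ‖x‖ ≤ R) {w : Lp F ∞ μ} :
    rigidMoments hR w = 0 ↔ w ∈ rigidOrthogonal μ := by
  simp only [ContinuousLinearMap.ext_iff, rigidMoments_apply, zero_apply, rigidOrthogonal,
    Set.mem_ofPred_eq]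

lemma rigidOrthogonal_eq_ker (hR : ∀ᵐ x ∂μ, ‖x‖ ≤ R) :
    rigidOrthogonal μ = {w | rigidMoments hR w = 0} :=
  Set.ext fun _ => (rigidMoments_eq_zero_iff hR).symm

lemma isClosed_rigidOrthogonal (hR : ∀ᵐ x ∂μ, ‖x‖ ≤ R) : IsClosed (rigidOrthogonal μ) := by
  rw [rigidOrthogonal_eq_ker hR]
  exact isClosed_eq (rigidMoments hR).continuous continuous_const

lemma mem_rigidOrthogonal_of_antisymm (hR : ∀ᵐ x ∂μ, ‖x‖ ≤ R) {Ψ : F → F → F}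
    (hΨ : ∀ x y, Ψ y x = -Ψ x y)
    (hdir : ∀ x y v, inner ℝ v (y - x) = 0 → inner ℝ (Ψ x y) v = 0)
    (hint : Integrable (fun q : F × F => Ψ q.1 q.2) (μ.prod μ)) {f : Lp F ∞ μ}
    (hf : f =ᵐ[μ] fun x => -∫ y, Ψ x y ∂μ) : f ∈ rigidOrthogonal μ := fun q => by
  rw [← neg_eq_zero, ← integral_neg,
    ← integral_inner_rigidMotion_eq_zero hΨ hdir hint (memLp_rigidMotion hR q ∞)]
  exact integral_congr_ae (hf.mono fun x hx => by simp only [hx, inner_neg_left, neg_neg])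

end RigidMoments

section Linearization

lemma exists_measurable_subtype_ae_eq {α β : Type*} [MeasurableSpace α] [MeasurableSpace β]
    {μ : Measure α} {f : α → β} (hf : AEMeasurable f μ) {s : Set β} (hs : s.Nonempty)
    (hfs : ∀ᵐ x ∂μ, f x ∈ s) : ∃ ι : α → s, Measurable ι ∧ ∀ᵐ x ∂μ, (ι x : β) = f x := by
  obtain ⟨g, hg, hgs, hfg⟩ := hf.exists_ae_eq_range_subset hfs hs
  exact ⟨fun x => ⟨g x, hgs ⟨x, rfl⟩⟩, hg.subtype_mk, hfg.symm⟩

variable {F : Type*} [NormedAddCommGroup F] [InnerProductSpace ℝ F] [FiniteDimensional ℝ F]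
  [MeasurableSpace F] [BorelSpace F] {ε C R γ : ℝ} {k : F → ℝ} {h : ℝ → ℝ} {Ω : Set F}
  {u w : F → F} {μ : Measure F} [IsFiniteMeasure μ]

namespace IsBondKernel

lemma mem_rigidOrthogonal_of_ae_eq_bondField (hk : IsBondKernel ε k) (hμ : μ ≤ volume)
    (hR : ∀ᵐ x ∂μ, ‖x‖ ≤ R) (hhm : Measurable h) (hhC : ∀ r, |h r| ≤ C)
    (hu : AEStronglyMeasurable u μ) (hw : Integrable w μ) {f : Lp F ∞ μ}
    (hf : f =ᵐ[μ] fun x => -∫ y, bondField k h u x y (w y - w x) ∂μ) : f ∈ rigidOrthogonal μ := by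
  refine mem_rigidOrthogonal_of_antisymm hR (Ψ := fun x y => bondField k h u x y (w y - w x))
    (fun x y => ?_) (fun x y v hv => ?_) ?_ hf
  · rw [hk.bondField_comm, ← map_neg, neg_sub]
  · rw [bondField, inner_bondTensor_apply, real_inner_comm v, dir, real_inner_smul_right, hv]
    simp
  · exact integrable_pairwise_apply_sub hμ (hk.integrable.norm.const_mul C)
      (aestronglyMeasurable_bondField hk.measurable hhm hu) (norm_bondField_le hhC) hw

set_option maxSynthPendingDepth 3 in
theorem exists_linearization (hk : IsBondKernel ε k) (hΩ : IsOpen Ω) (hconn : IsConnected Ω)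
    [IsFiniteMeasure (volume.restrict Ω)] (hR : ∀ᵐ x ∂volume.restrict Ω, ‖x‖ ≤ R) (hε : 0 < ε)
    (hh : Continuous h) (hhC : ∀ r, |h r| ≤ C) (hhpos : ∀ s ∈ bondStretches Ω ε u, 0 < h s)
    (hγ : 0 < γ)
    (hcoercive : ∀ x ∈ Ω, ∀ v, γ * ‖v‖ ^ 2 ≤ inner ℝ ((∫ y in Ω, bondField k h u x y) v) v)
    (hu : MemLp u ∞ (volume.restrict Ω)) :
    ∃ T : Lp F ∞ (volume.restrict Ω) →L[ℝ] Lp F ∞ (volume.restrict Ω),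
      (∀ w, T w =ᵐ[volume.restrict Ω] fun x => -∫ y in Ω, bondField k h u x y (w y - w x)) ∧
      Set.BijOn T (rigidOrthogonal (volume.restrict Ω)) (rigidOrthogonal (volume.restrict Ω)) := by
  set μ := volume.restrict Ω
  have hμ : μ ≤ volume := Measure.restrict_le_self
  have hproper := FiniteDimensional.proper ℝ F
  set S := Metric.closedBall (0 : F) |R| ×ˢ Metric.closedBall (0 : F) ‖hu.toLp u‖
  obtain ⟨ι, hι, hιu⟩ := exists_measurable_subtype_ae_eq (f := fun x => (x, u x))
    (aemeasurable_id.prodMk hu.1.aemeasurable)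
    (s := S) ⟨0, by simp [S]⟩ <| by
      filter_upwards [hR, hu.coeFn_toLp, ae_norm_le_norm_Linfty (hu.toLp u)] with x hxR hux hle
      exact ⟨by simpa using hxR.trans (le_abs_self R), by simpa [hux] using hle⟩
  have := isCompact_iff_compactSpace.1 <|
    (isCompact_closedBall (0 : F) |R|).prod (isCompact_closedBall (0 : F) ‖hu.toLp u‖)
  let κ : C(S, Lp (F →L[ℝ] F) 1 μ) :=
    ⟨fun q => hk.bondFamily hμ hh hhC hu.1 q,
      (hk.continuous_bondFamily hμ hh hhC hu.1).comp continuous_subtype_val⟩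
  have hκ : ∀ᵐ x ∂μ, κ (ι x) =ᵐ[μ] bondField k h u x := by
    filter_upwards [hιu] with x hx
    change hk.bondFamily hμ hh hhC hu.1 (ι x) =ᵐ[μ] bondField k h u x
    rw [hx]
    exact MemLp.coeFn_toLp _
  have hT (w) : nonlocalOp κ hι w =ᵐ[μ] fun x => -∫ y, bondField k h u x y (w y - w x) ∂μ := by
    filter_upwards [coeFn_nonlocalOp κ hι w, hκ] with x hTx hκx
    rw [hTx, ← integral_neg]
    refine integral_congr_ae (hκx.mono fun y hy => ?_)
    simp only [hy, ← map_neg, neg_sub]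
  refine ⟨nonlocalOp κ hι, hT, ?_⟩
  rw [rigidOrthogonal_eq_ker hR]
  refine bijOn_ker_nonlocalOp (N := rigidMoments hR) hγ ?_ (fun w => ?_) fun w hw hTw => ?_
  · filter_upwards [hκ, ae_restrict_mem hΩ.measurableSet] with x hx hxΩ
    rw [integral_congr_ae hx]
    exact hcoercive x hxΩ
  · exact (rigidMoments_eq_zero_iff hR).2 <| hk.mem_rigidOrthogonal_of_ae_eq_bondField hμ hR
      hh.measurable hhC hu.1 ((Lp.memLp w).integrable le_top) (hT w)
  · refine Lp.eq_zero_iff_ae_eq_zero.2 (hk.ae_eq_zero_of_equilibrium hΩ hconn hε hh.measurable hhC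
      hhpos hu.1 ((Lp.memLp w).mono_exponent le_top) ((rigidMoments_eq_zero_iff hR).1 hw) ?_)
    filter_upwards [hT w, Lp.eq_zero_iff_ae_eq_zero.1 hTw] with x hx hx0
    rw [← neg_eq_zero, ← hx, hx0, Pi.zero_apply]

end IsBondKernel

end Linearization

section Force

lemma abs_sub_sub_mul_le {φ h h' : ℝ → ℝ} {C : ℝ} (hφ : ∀ r, HasDerivAt φ (h r) r)
    (hh : ∀ r, HasDerivAt h (h' r) r) (hC : ∀ r, |h' r| ≤ C) (s t : ℝ) :
    |φ (s + t) - φ s - h s * t| ≤ C * t ^ 2 := by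
  have hC0 : 0 ≤ C := (abs_nonneg _).trans (hC 0)
  have hlip (r : ℝ) : |h r - h s| ≤ C * |r - s| :=
    convex_univ.norm_image_sub_le_of_norm_hasDerivWithin_le
      (fun x _ => (hh x).hasDerivWithinAt) (fun x _ => hC x) trivial trivial
  have hmvt := (convex_closedBall s |t|).norm_image_sub_le_of_norm_hasDerivWithin_le
    (f := fun r => φ r - h s * r) (f' := fun r => h r - h s) (C := C * |t|) (y := s + t)
    (fun x _ => ((hφ x).sub (by simpa using (hasDerivAt_id x).const_mul (h s))).hasDerivWithinAt)
    (fun x hx => (hlip x).trans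
      (mul_le_mul_of_nonneg_left (by simpa [Real.dist_eq] using hx) hC0))
    (Metric.mem_closedBall_self (abs_nonneg t)) (by simp)
  rw [add_sub_cancel_left, Real.norm_eq_abs, Real.norm_eq_abs, mul_assoc, ← sq, sq_abs] at hmvt
  convert hmvt using 2
  ring

variable {F : Type*} [NormedAddCommGroup F] [InnerProductSpace ℝ F]

/-- The force of the bond `z` under the relative displacement `p`, where `φ` is the derivative of
the bond potential. -/
def bondForce (k : F → ℝ) (φ : ℝ → ℝ) (z p : F) : F :=
  (k z * √‖z‖ * φ (stretch z p)) • dir z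

variable {k : F → ℝ} {φ h : ℝ → ℝ} {C : ℝ}

lemma bondForce_neg_neg (hk : ∀ z, k (-z) = k z) (z p : F) :
    bondForce k φ (-z) (-p) = -bondForce k φ z p := by
  rw [bondForce, bondForce, hk, norm_neg, stretch_neg_neg, dir_neg, smul_neg]

lemma inner_bondForce_eq_zero (p : F) {z v : F} (hv : inner ℝ v z = 0) :
    inner ℝ (bondForce k φ z p) v = 0 := by
  rw [bondForce, dir, smul_smul, real_inner_smul_left, real_inner_comm, hv, mul_zero]

lemma measurable_bondForce [MeasurableSpace F] [BorelSpace F] [SecondCountableTopology F]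
    (hk : Measurable k) (hφ : Measurable φ) :
    Measurable fun q : F × F => bondForce k φ q.1 q.2 :=
  (((hk.comp measurable_fst).mul measurable_fst.norm.sqrt).mul (hφ.comp measurable_stretch)).smul
    (measurable_dir.comp measurable_fst)

lemma ae_integral_bondForce_congr [MeasurableSpace F] {μ : Measure F} {u v : F → F}
    (huv : u =ᵐ[μ] v) :
    (fun x => ∫ y, bondForce k φ (y - x) (u y - u x) ∂μ) =ᵐ[μ]
      fun x => ∫ y, bondForce k φ (y - x) (v y - v x) ∂μ :=
  huv.mono fun x hx => integral_congr_ae (huv.mono fun y hy => by simp only [hx, hy])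

lemma norm_integral_le_integral_of_norm_le_comp_sub {G H : Type*} [AddGroup G]
    [MeasurableSpace G] [MeasurableAdd G] {ν μ : Measure G} [ν.IsAddRightInvariant]
    [NormedAddCommGroup H] [NormedSpace ℝ H] (hμ : μ ≤ ν) {b : G → ℝ} (hb : Integrable b ν)
    (hb0 : ∀ z, 0 ≤ b z) {f : G → H} {x : G} (hf : ∀ᵐ y ∂μ, ‖f y‖ ≤ b (y - x)) :
    ‖∫ y, f y ∂μ‖ ≤ ∫ z, b z ∂ν :=
  calc ‖∫ y, f y ∂μ‖ ≤ ∫ y, b (y - x) ∂μ :=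
        norm_integral_le_of_norm_le ((hb.comp_sub_right x).mono_measure hμ) hf
    _ ≤ ∫ y, b (y - x) ∂ν :=
        integral_mono_measure hμ (.of_forall fun _ => hb0 _) (hb.comp_sub_right x)
    _ = ∫ z, b z ∂ν := integral_sub_right_eq_self b x

namespace IsBondKernel

variable [FiniteDimensional ℝ F] [MeasurableSpace F] [BorelSpace F] {ε R : ℝ} {u v w : F → F}
  {μ : Measure F}

lemma norm_bondForce_le (hk : IsBondKernel ε k) (hφ : ∀ r, |φ r| ≤ C) (z p : F) :
    ‖bondForce k φ z p‖ ≤ C * √ε * k z := by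
  have hC : 0 ≤ C := (abs_nonneg _).trans (hφ 0)
  rcases (hk.nonneg z).eq_or_lt with h0 | hpos
  · simp [bondForce, ← h0]
  have hlt := ((hk.pos_iff z).1 hpos).2
  rw [bondForce, norm_smul, norm_mul, norm_mul, Real.norm_of_nonneg hpos.le,
    Real.norm_of_nonneg (Real.sqrt_nonneg _)]
  calc k z * √‖z‖ * ‖φ (stretch z p)‖ * ‖dir z‖ ≤ k z * √ε * C * 1 := by
        gcongr
        exacts [hφ _, norm_dir_le z]
    _ = C * √ε * k z := by ring

lemma norm_bondForce_add_sub_sub_le (hk : IsBondKernel ε k)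
    (hφ : ∀ s t, |φ (s + t) - φ s - h s * t| ≤ C * t ^ 2) (z p q : F) :
    ‖bondForce k φ z (p + q) - bondForce k φ z p - bondTensor k h z p q‖
      ≤ C * ((√‖z‖)⁻¹ * k z) * ‖q‖ ^ 2 := by
  rcases (hk.nonneg z).eq_or_lt with h0 | hpos
  · simp [bondForce, bondTensor, ← h0]
  have hC : 0 ≤ C := by simpa using (abs_nonneg _).trans (hφ 0 1)
  have hz : 0 < √‖z‖ := Real.sqrt_pos.2 (norm_pos_iff.2 ((hk.pos_iff z).1 hpos).1)
  have hinner : inner ℝ (dir z) q = √‖z‖ * stretch z q := by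
    rw [stretch, mul_inv_cancel_left₀ hz.ne', real_inner_comm]
  have hq : stretch z q ^ 2 ≤ ((√‖z‖)⁻¹ * ‖q‖) ^ 2 := sq_le_sq' (abs_le.1 (abs_stretch_le z q)).1
    (abs_le.1 (abs_stretch_le z q)).2
  have hremainder : bondForce k φ z (p + q) - bondForce k φ z p - bondTensor k h z p q
      = (k z * √‖z‖ * (φ (stretch z p + stretch z q) - φ (stretch z p)
        - h (stretch z p) * stretch z q)) • dir z := by
    rw [bondForce, bondForce, bondTensor_apply, hinner, stretch_add, ← sub_smul, ← sub_smul]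
    congr 1
    ring
  rw [hremainder, norm_smul, norm_mul, Real.norm_of_nonneg (by positivity)]
  calc k z * √‖z‖ * ‖φ (stretch z p + stretch z q) - φ (stretch z p)
        - h (stretch z p) * stretch z q‖ * ‖dir z‖
      ≤ k z * √‖z‖ * (C * ((√‖z‖)⁻¹ * ‖q‖) ^ 2) * 1 := by
        gcongr
        exacts [(hφ _ _).trans (by gcongr), norm_dir_le z]
    _ = C * ((√‖z‖)⁻¹ * k z) * ‖q‖ ^ 2 := by field_simp

lemma aestronglyMeasurable_bondForce [SFinite μ] (hk : IsBondKernel ε k) (hφ : Measurable φ)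
    (hu : AEStronglyMeasurable u μ) :
    AEStronglyMeasurable (fun q : F × F => bondForce k φ (q.2 - q.1) (u q.2 - u q.1))
      (μ.prod μ) :=
  ((measurable_bondForce hk.measurable hφ).comp_aemeasurable
    ((measurable_snd.sub measurable_fst).aemeasurable.prodMk
      (hu.comp_snd.sub hu.comp_fst).aemeasurable)).aestronglyMeasurable

lemma integrable_bondForce (hk : IsBondKernel ε k) (hμ : μ ≤ volume) (hφ : Measurable φ)
    (hφC : ∀ r, |φ r| ≤ C) (hu : AEStronglyMeasurable u μ) (x : F) :
    Integrable (fun y => bondForce k φ (y - x) (u y - u x)) μ :=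
  (((hk.integrable.comp_sub_right x).const_mul (C * √ε)).mono_measure hμ).mono'
    ((measurable_bondForce hk.measurable hφ).comp_aemeasurable
      ((measurable_id.sub_const x).aemeasurable.prodMk
        (hu.aemeasurable.sub_const (u x)))).aestronglyMeasurable
    (.of_forall fun _ => hk.norm_bondForce_le hφC _ _)

lemma exists_rigidOrthogonal_ae_eq_force [IsFiniteMeasure μ] (hk : IsBondKernel ε k)
    (hμ : μ ≤ volume) (hR : ∀ᵐ x ∂μ, ‖x‖ ≤ R) (hφ : Measurable φ) (hφC : ∀ r, |φ r| ≤ C)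
    (hu : AEStronglyMeasurable u μ) :
    ∃ f ∈ rigidOrthogonal μ, f =ᵐ[μ] fun x => -∫ y, bondForce k φ (y - x) (u y - u x) ∂μ := by
  have hmeas := hk.aestronglyMeasurable_bondForce hφ hu
  have hbound := hk.norm_bondForce_le hφC
  have hmem : MemLp (fun x => -∫ y, bondForce k φ (y - x) (u y - u x) ∂μ) ∞ μ := by
    refine memLp_top_of_bound hmeas.integral_prod_right'.neg (∫ z, C * √ε * k z)
      (.of_forall fun x => ?_)
    rw [norm_neg]
    exact norm_integral_le_integral_of_norm_le_comp_sub hμ (hk.integrable.const_mul _)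
      (fun z => (norm_nonneg _).trans (hbound z 0)) (.of_forall fun y => hbound _ _)
  refine ⟨hmem.toLp, mem_rigidOrthogonal_of_antisymm hR (fun x y => ?_)
    (fun x y v hv => inner_bondForce_eq_zero _ hv) ?_ hmem.coeFn_toLp, hmem.coeFn_toLp⟩
  · rw [← neg_sub y x, ← neg_sub (u y), bondForce_neg_neg hk.even]
  · refine integrable_prod_of_norm_le_mul_add (f := fun _ => C * √ε / 2) hμ hk.integrable
      (integrable_const _) hmeas (.of_forall fun q => (hbound _ _).trans_eq ?_)
    ring

lemma norm_integral_bondForce_sub_sub_le (hk : IsBondKernel ε k) (hμ : μ ≤ volume)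
    (hφm : Measurable φ) (hφC : ∀ r, |φ r| ≤ C) (hhm : Measurable h) {C₁ C₂ : ℝ}
    (hhC : ∀ r, |h r| ≤ C₁) (hφ : ∀ s t, |φ (s + t) - φ s - h s * t| ≤ C₂ * t ^ 2)
    (hu : AEStronglyMeasurable u μ) (hw : AEStronglyMeasurable w μ) {m : ℝ}
    (hwm : ∀ᵐ y ∂μ, ‖w y‖ ≤ m) {x : F} (hx : ‖w x‖ ≤ m) :
    ‖(∫ y, bondForce k φ (y - x) ((u + w) y - (u + w) x) ∂μ)
        - (∫ y, bondForce k φ (y - x) (u y - u x) ∂μ)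
        - ∫ y, bondField k h u x y (w y - w x) ∂μ‖
      ≤ (∫ z, C₂ * 4 * ((√‖z‖)⁻¹ * k z)) * m ^ 2 := by
  have hC₂ : 0 ≤ C₂ := by simpa using (abs_nonneg _).trans (hφ 0 1)
  have hfield : Integrable (fun y => bondField k h u x y (w y - w x)) μ := by
    have hB := hk.integrable_bondField hμ hhm hhC hu x
    refine (hB.norm.mul_const (m + m)).mono'
      (isBoundedBilinearMap_apply.continuous.comp_aestronglyMeasurable
        (hB.1.prodMk (hw.sub aestronglyMeasurable_const))) (hwm.mono fun y hy => ?_)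
    exact (bondField k h u x y).le_opNorm_of_le (norm_sub_le_of_le hy hx)
  have hforce := hk.integrable_bondForce hμ hφm hφC hu x
  have hforce' := hk.integrable_bondForce hμ hφm hφC (hu.add hw) x
  rw [← integral_sub hforce' hforce, ← integral_sub (hforce'.sub' hforce) hfield,
    ← integral_mul_const]
  refine norm_integral_le_integral_of_norm_le_comp_sub (x := x) hμ
    ((hk.integrable_inv_sqrt_mul.const_mul _).mul_const _) (fun z => ?_) ?_
  · have := hk.nonneg z
    positivity
  filter_upwards [hwm] with y hy
  have hrel : ‖w y - w x‖ ≤ 2 * m := (norm_sub_le _ _).trans (by linarith)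
  have hk0 := hk.nonneg (y - x)
  calc _ = ‖bondForce k φ (y - x) ((u y - u x) + (w y - w x)) - bondForce k φ (y - x) (u y - u x)
        - bondTensor k h (y - x) (u y - u x) (w y - w x)‖ := by
        rw [Pi.add_apply, Pi.add_apply, add_sub_add_comm, bondField]
    _ ≤ C₂ * ((√‖y - x‖)⁻¹ * k (y - x)) * ‖w y - w x‖ ^ 2 :=
        hk.norm_bondForce_add_sub_sub_le hφ _ _ _
    _ ≤ C₂ * ((√‖y - x‖)⁻¹ * k (y - x)) * (2 * m) ^ 2 := by gcongr
    _ = C₂ * 4 * ((√‖y - x‖)⁻¹ * k (y - x)) * m ^ 2 := by ring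

theorem hasFDerivAt_force (hk : IsBondKernel ε k) (hμ : μ ≤ volume) [IsFiniteMeasure μ]
    (hφm : Measurable φ) (hφC : ∀ r, |φ r| ≤ C) (hhm : Measurable h) {C₁ C₂ : ℝ}
    (hhC : ∀ r, |h r| ≤ C₁) (hφ : ∀ s t, |φ (s + t) - φ s - h s * t| ≤ C₂ * t ^ 2)
    (hu : MemLp u ∞ μ) {f : Lp F ∞ μ → Lp F ∞ μ} {T : Lp F ∞ μ →L[ℝ] Lp F ∞ μ}
    (hf : ∀ v, f v =ᵐ[μ] fun x => -∫ y, bondForce k φ (y - x) (v y - v x) ∂μ)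
    (hT : ∀ w, T w =ᵐ[μ] fun x => -∫ y, bondField k h u x y (w y - w x) ∂μ) :
    HasFDerivAt f T (hu.toLp u) := by
  have hC₂ : 0 ≤ C₂ := by simpa using (abs_nonneg _).trans (hφ 0 1)
  set M := ∫ z, C₂ * 4 * ((√‖z‖)⁻¹ * k z)
  have hM : 0 ≤ M := integral_nonneg fun z => by have := hk.nonneg z; positivity
  have hquad (v : Lp F ∞ μ) :
      ‖f v - f (hu.toLp u) - T (v - hu.toLp u)‖ ≤ M * ‖v - hu.toLp u‖ ^ 2 := by
    set w := v - hu.toLp u with hw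
    have hv : v =ᵐ[μ] u + w := by
      filter_upwards [Lp.coeFn_sub v (hu.toLp u), hu.coeFn_toLp] with y hwy huy
      rw [hw, Pi.add_apply, hwy, Pi.sub_apply, huy, add_sub_cancel]
    refine norm_Linfty_le_of_ae_le (by positivity) ?_
    filter_upwards [Lp.coeFn_sub (f v - f (hu.toLp u)) (T w), Lp.coeFn_sub (f v) (f (hu.toLp u)),
      hf v, hf (hu.toLp u), hT w, ae_integral_bondForce_congr (k := k) (φ := φ) hv,
      ae_integral_bondForce_congr (k := k) (φ := φ) hu.coeFn_toLp, ae_norm_le_norm_Linfty w]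
      with x hsub hsub' hfv hfu hTw hcv hcu hwx
    rw [hsub, Pi.sub_apply, hsub', Pi.sub_apply, hfv, hfu, hTw, hcv, hcu, ← norm_neg]
    refine (congrArg norm ?_).trans_le (hk.norm_integral_bondForce_sub_sub_le hμ hφm hφC hhm hhC
      hφ hu.1 (Lp.aestronglyMeasurable w) (ae_norm_le_norm_Linfty w) hwx)
    abel
  rw [hasFDerivAt_iff_isLittleO]
  refine Asymptotics.IsBigO.trans_isLittleO (g := fun v => ‖v - hu.toLp u‖ ^ 2) ?_
    (Asymptotics.isLittleO_pow_sub_sub _ one_lt_two)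
  exact Asymptotics.IsBigO.of_bound M (.of_forall fun v => by simpa using hquad v)

end IsBondKernel

end Force

section Cone

open InnerProductGeometry in
lemma one_sub_le_one_add_mul_cos_angle {F : Type*} [NormedAddCommGroup F] [InnerProductSpace ℝ F]
    {z f : F} {τ : ℝ} (hτ : τ < 1) (hf : f ≠ 0) (h : ‖z - f‖ ≤ τ * ‖f‖) :
    1 - τ ≤ (1 + τ) * Real.cos (angle z f) := by
  have hf0 := norm_pos_iff.2 hf
  have hnorm : ‖z‖ ≤ (1 + τ) * ‖f‖ := by linarith [norm_le_norm_add_norm_sub' z f]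
  have hinner : (1 - τ) * ‖f‖ ^ 2 ≤ inner ℝ z f := by
    have hsplit : inner ℝ z f = ‖f‖ ^ 2 + inner ℝ (z - f) f := by
      rw [inner_sub_left, real_inner_self_eq_norm_sq]
      ring
    nlinarith [neg_le_of_abs_le (abs_real_inner_le_norm (z - f) f)]
  rw [← cos_angle_mul_norm_mul_norm] at hinner
  have hcos : 0 ≤ Real.cos (angle z f) := by
    refine (pos_of_mul_pos_left (lt_of_lt_of_le ?_ hinner) (by positivity)).le
    have := sub_pos.2 hτ
    positivity
  have : Real.cos (angle z f) * (‖z‖ * ‖f‖) ≤ Real.cos (angle z f) * ((1 + τ) * ‖f‖ * ‖f‖) := by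
    gcongr
  nlinarith [pow_pos hf0 2]

variable {d : ℕ} {Ω : Set (E d)} {ε θ : ℝ}

lemma exists_ball_subset_cone (hθ : 0 < θ) :
    ∃ τ > 0, ∀ s l : ℝ, 0 < s → 2 * s ≤ l → ∀ x e : E d, ‖e‖ = 1 →
      Metric.ball (x + s • e) (τ * s) ⊆ cone l θ x e := by
  set θ' := min θ Real.pi
  have hθ' : 0 < θ' := lt_min hθ Real.pi_pos
  have hcos : Real.cos θ' < 1 := by
    simpa using Real.cos_lt_cos_of_nonneg_of_le_pi le_rfl (min_le_right _ _) hθ'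
  have hcos' : -1 ≤ Real.cos θ' := Real.neg_one_le_cos _
  obtain ⟨τ, hτ0, hτ1, hτ⟩ : ∃ τ, 0 < τ ∧ τ < 1 ∧ (1 + τ) * Real.cos θ' ≤ 1 - τ :=
    ⟨(1 - Real.cos θ') / 3, by linarith, by linarith, by nlinarith⟩
  refine ⟨τ, hτ0, fun s l hs hsl x e he y hy => Or.inr ?_⟩
  have hnorm : ‖s • e‖ = s := by rw [norm_smul, he, mul_one, Real.norm_of_nonneg hs.le]
  have hse : s • e ≠ 0 := norm_pos_iff.1 (hnorm.symm ▸ hs)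
  have hdist : ‖(y - x) - s • e‖ ≤ τ * ‖s • e‖ := by
    rw [hnorm, sub_sub]
    exact (mem_ball_iff_norm.1 hy).le
  refine ⟨by nlinarith [norm_le_norm_add_norm_sub' (y - x) (s • e)], ?_⟩
  by_contra! hangle
  have hlt := Real.cos_lt_cos_of_nonneg_of_le_pi hθ'.le (InnerProductGeometry.angle_le_pi (y - x) e)
    ((min_le_left _ _).trans_lt hangle)
  have hle := one_sub_le_one_add_mul_cos_angle hτ1 hse hdist
  rw [InnerProductGeometry.angle_smul_right_of_pos _ _ hs] at hle
  nlinarith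

lemma InteriorConeCondition.exists_ball_subset (hΩ : InteriorConeCondition Ω) (hε : 0 < ε) :
    ∃ s < ε, ∃ ρ > 0, ∀ x ∈ Ω, ∃ e : E d, ‖e‖ = s ∧ Metric.ball (x + e) ρ ⊆ Ω := by
  obtain ⟨θ, hθ, l, hl, hcone⟩ := hΩ
  obtain ⟨τ, hτ, hball⟩ := exists_ball_subset_cone (d := d) hθ
  have hs : 0 < min l ε / 2 := half_pos (lt_min hl hε)
  refine ⟨min l ε / 2, by linarith [min_le_right l ε], τ * (min l ε / 2), by positivity,
    fun x hx => ?_⟩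
  obtain ⟨e, he, hsub⟩ := hcone x hx
  refine ⟨(min l ε / 2) • e, ?_, (hball _ l hs (by linarith [min_le_left l ε]) x e he).trans hsub⟩
  rw [norm_smul, he, mul_one, Real.norm_of_nonneg hs.le]

end Cone

section Model

variable {d : ℕ} {Ω : Set (E d)} {ε : ℝ} {J g : ℝ → ℝ}

/-- The bond weight `2 J^ε(|z|) / (ε^(d+1) ω_d |z|)`, cut off at the horizon. The cutoff matters
only for `|z| = ε`, as `J` is allowed to be nonzero at `1`. -/
def bondKernel (ε : ℝ) (J : ℝ → ℝ) : E d → ℝ :=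
  (Metric.ball 0 ε).indicator fun z =>
    2 * (J (‖z‖ / ε) / (ε ^ (d + 1) * unitBallVolume d * ‖z‖))

lemma unitBallVolume_pos : 0 < unitBallVolume d :=
  ENNReal.toReal_pos (Metric.measure_ball_pos volume 0 one_pos).ne' measure_ball_lt_top.ne

lemma bondKernel_nonneg (hε : 0 < ε) (hJ : IsInfluenceFunction J) (z : E d) :
    0 ≤ bondKernel ε J z := by
  refine Set.indicator_nonneg (fun z _ => ?_) z
  have := hJ.nonneg (‖z‖ / ε)
  have := unitBallVolume_pos (d := d)
  positivity

lemma bondKernel_pos_iff (hε : 0 < ε) (hJ : IsInfluenceFunction J) (z : E d) :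
    0 < bondKernel ε J z ↔ z ≠ 0 ∧ ‖z‖ < ε := by
  refine ⟨fun hpos => ⟨?_, ?_⟩, fun ⟨hz, hzε⟩ => ?_⟩
  · rintro rfl
    simp [bondKernel, Set.indicator] at hpos
  · by_contra hz
    rw [bondKernel, Set.indicator_of_notMem (by simpa using hz)] at hpos
    exact hpos.false
  · have := norm_pos_iff.2 hz
    have := hJ.pos (‖z‖ / ε) ⟨by positivity, (div_lt_one hε).2 hzε⟩
    have := unitBallVolume_pos (d := d)
    rw [bondKernel, Set.indicator_of_mem (by simpa using hzε)]
    positivity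

lemma exists_bondKernel_le (hε : 0 < ε) (hJ : IsInfluenceFunction J) :
    ∃ C, ∀ z : E d, bondKernel ε J z ≤ C * ‖z‖⁻¹ := by
  obtain ⟨C, hC⟩ := hJ.bounded
  have hω := unitBallVolume_pos (d := d)
  have hC0 : 0 ≤ C := (abs_nonneg _).trans (hC 0)
  refine ⟨2 * (C / (ε ^ (d + 1) * unitBallVolume d)), fun z => ?_⟩
  refine Set.indicator_apply_le' (fun _ => ?_) (fun _ => by positivity)
  rw [← div_div, div_eq_mul_inv _ ‖z‖, ← mul_assoc]
  gcongr
  exact (le_abs_self _).trans (hC _)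

lemma isBondKernel_bondKernel (hd : 2 ≤ d) (hε : 0 < ε) (hJ : IsInfluenceFunction J) :
    IsBondKernel ε (bondKernel ε J : E d → ℝ) := by
  have hd' : (2 : ℝ) ≤ d := by exact_mod_cast hd
  have hmeas : Measurable (bondKernel ε J : E d → ℝ) := by
    have := hJ.measurable
    exact Measurable.indicator (by fun_prop) measurableSet_ball
  refine ⟨hmeas, bondKernel_nonneg hε hJ, bondKernel_pos_iff hε hJ, fun z z' hz => ?_, ?_⟩
  · simp only [bondKernel, Set.indicator, mem_ball_zero_iff, hz]
  obtain ⟨C, hC⟩ := exists_bondKernel_le (d := d) hε hJ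
  have hbound (z : E d) : ‖(√‖z‖)⁻¹ * bondKernel ε J z‖ ≤ C * ‖z‖ ^ (-(3 / 2) : ℝ) := by
    rcases eq_or_ne z 0 with rfl | hz
    · simp [bondKernel, Set.indicator]
    have hpow : ‖z‖ ^ (-(3 / 2) : ℝ) = (√‖z‖)⁻¹ * ‖z‖⁻¹ := by
      rw [Real.sqrt_eq_rpow, ← Real.rpow_neg (norm_nonneg z), ← Real.rpow_neg_one,
        ← Real.rpow_add (norm_pos_iff.2 hz)]
      norm_num
    rw [Real.norm_of_nonneg (mul_nonneg (by positivity) (bondKernel_nonneg hε hJ z)), hpow,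
      mul_left_comm]
    gcongr
    exact hC z
  rw [← integrableOn_iff_integrable_of_support_subset (s := Metric.ball 0 ε)]
  · exact integrableOn_ball_of_norm_le_rpow (by simp; omega) (by simp; linarith)
      (.of_forall hbound) (by fun_prop)
  · exact (Function.support_mul_subset_right _ _).trans Set.support_indicator_subset

lemma sqrt_mul_strain (x y : E d) (u : E d → E d) :
    √‖y - x‖ * strain y x u = stretch (y - x) (u y - u x) := by
  rw [strain, real_inner_smul_left, ← mul_assoc, ← div_eq_mul_inv, Real.sqrt_div_self]
  rfl

lemma setIntegral_nbhd_eq {G : Type*} [NormedAddCommGroup G] [NormedSpace ℝ G] (x : E d)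
    {f f' : E d → G} (hf : ∀ y ∈ Metric.ball x ε, f y = f' y)
    (hf' : ∀ y, bondKernel ε J (y - x) = 0 → f' y = 0) :
    ∫ y in nbhd Ω ε x, f y = ∫ y in Ω, f' y := by
  rw [nbhd, Set.inter_comm, ← setIntegral_indicator measurableSet_ball]
  congr 1 with y
  by_cases hy : y ∈ Metric.ball x ε
  · rw [Set.indicator_of_mem hy, hf y hy]
  · rw [Set.indicator_of_notMem hy,
      hf' y (Set.indicator_of_notMem (by simpa [dist_eq_norm] using hy) _)]

lemma bondKernel_sub {x y : E d} (hy : y ∈ Metric.ball x ε) : bondKernel ε J (y - x)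
    = 2 * (J (‖y - x‖ / ε) / (ε ^ (d + 1) * unitBallVolume d * ‖y - x‖)) :=
  Set.indicator_of_mem (by simpa [dist_eq_norm] using hy) _

lemma force_eq_neg_integral_bondForce (u : E d → E d) :
    force Ω ε J g u = fun x =>
      -∫ y in Ω, bondForce (bondKernel ε J) (deriv g) (y - x) (u y - u x) := by
  refine funext fun x => congrArg Neg.neg <|
    setIntegral_nbhd_eq (J := J) x (fun y hy => ?_) fun y hy => ?_
  · rw [bondForce, bondKernel_sub hy, sqrt_mul_strain, bondDir, dir]
    congr 2
    rw [mul_assoc 2, ← div_div _ _ ‖y - x‖, ← div_div _ _ √‖y - x‖, div_eq_mul_inv _ √‖y - x‖,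
      ← Real.sqrt_div_self, mul_div_assoc', mul_div_right_comm]
  · rw [bondForce, hy, zero_mul, zero_mul, zero_smul]

lemma forceDeriv_eq_neg_integral_bondField (u w : E d → E d) :
    forceDeriv Ω ε J g u w = fun x =>
      -∫ y in Ω, bondField (bondKernel ε J) (iteratedDeriv 2 g) u x y (w y - w x) := by
  refine funext fun x => congrArg Neg.neg <|
    setIntegral_nbhd_eq (J := J) x (fun y hy => ?_) fun y hy => ?_
  · rw [bondField, bondTensor_apply, bondKernel_sub hy, sqrt_mul_strain, strain,
      real_inner_smul_left, real_inner_comm, ← div_div _ _ ‖y - x‖, div_eq_mul_inv _ ‖y - x‖,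
      bondDir, dir]
    congr 1
    ring
  · rw [bondField, bondTensor_apply, hy, zero_mul, zero_mul, zero_smul]

lemma stabilityTensor_eq_smul_integral_bondField (u : E d → E d) (x : E d) :
    stabilityTensor Ω ε J g u x
      = (2⁻¹ : ℝ) • ∫ y in Ω, bondField (bondKernel ε J) (iteratedDeriv 2 g) u x y := by
  rw [← integral_smul]
  refine setIntegral_nbhd_eq (J := J) x (fun y hy => ?_) fun y hy => ?_
  · rw [bondField, bondTensor, bondKernel_sub hy, sqrt_mul_strain, smul_smul, mul_assoc 2,
      inv_mul_cancel_left₀ two_ne_zero]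
    rfl
  · rw [bondField, bondTensor, hy, zero_mul, zero_smul, smul_zero]

end Model

section Restriction

variable {X : Type*} [NormedAddCommGroup X] [NormedSpace ℝ X] {N : Submodule ℝ X} {T : X →L[ℝ] X}

lemma exists_continuousLinearEquiv_of_bijOn [CompleteSpace X] (hN : IsClosed (N : Set X))
    (hT : Set.BijOn T N N) : ∃ T' : N ≃L[ℝ] N, ∀ w, (T' w : X) = T w := by
  have := hN.completeSpace_coe
  let T₀ : N →L[ℝ] N := T.restrict hT.mapsTo
  have hinj : Function.Injective T₀ := fun v w h =>
    Subtype.ext (hT.injOn v.2 w.2 (congrArg Subtype.val h))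
  have hsurj : Function.Surjective T₀ := fun v =>
    let ⟨w, hw, h⟩ := hT.surjOn v.2
    ⟨⟨w, hw⟩, Subtype.ext h⟩
  exact ⟨.ofBijective T₀ (LinearMap.ker_eq_bot.2 hinj) (LinearMap.range_eq_top.2 hsurj),
    fun _ => rfl⟩

lemma hasFDerivAt_restrict {f : X → X} {L : N → N} {T' : N →L[ℝ] N} {u : N}
    (hf : HasFDerivAt f T u) (hL : ∀ v, (L v : X) = f v) (hT' : ∀ w, (T' w : X) = T w) :
    HasFDerivAt L T' u := by
  have hcomp := hf.comp u N.subtypeL.hasFDerivAt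
  rw [hasFDerivAt_iff_isLittleO] at hcomp ⊢
  refine (hcomp.norm_left.congr_left fun v => ?_).of_norm_left
  change ‖f v - f u - T ((v - u : N) : X)‖ = ‖(L v - L u - T' (v - u) : X)‖
  rw [hL, hL, hT']

end Restriction

section RigidMotions

lemma mem_skew_iff_star_eq_neg {F : Type*} [NormedAddCommGroup F] [InnerProductSpace ℝ F]
    [CompleteSpace F] {A : F →L[ℝ] F} : A ∈ skew F ↔ star A = -A := by
  refine ⟨fun hA => ?_, fun hA v => ?_⟩
  · refine ContinuousLinearMap.ext fun v => ext_inner_right ℝ fun w => ?_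
    have hpolar := hA (v + w)
    rw [map_add, inner_add_left, inner_add_right, inner_add_right, hA, hA] at hpolar
    rw [ContinuousLinearMap.star_eq_adjoint, ContinuousLinearMap.adjoint_inner_left, neg_apply,
      inner_neg_left, real_inner_comm]
    linarith
  · have hself : inner ℝ (A v) v = -inner ℝ (A v) v := by
      conv_lhs => rw [real_inner_comm, ← ContinuousLinearMap.adjoint_inner_left,
        ← ContinuousLinearMap.star_eq_adjoint, hA, neg_apply, inner_neg_left]
    linarith

variable {d : ℕ} {Ω : Set (E d)} [IsFiniteMeasure (volume.restrict Ω)] {R : ℝ}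

lemma rigidMotions_eq_range : rigidMotions d = Set.range (rigidMotion (F := E d)) := by
  ext w
  constructor
  · rintro ⟨Q, c, hQ, hw⟩
    refine ⟨(⟨Matrix.toEuclideanCLM (𝕜 := ℝ) Q, mem_skew_iff_star_eq_neg.2 ?_⟩, c),
      funext fun x => (hw x).symm⟩
    rw [← map_star, Matrix.star_eq_conjTranspose, Matrix.conjTranspose_eq_transpose_of_trivial, hQ,
      map_neg]
  · rintro ⟨⟨A, c⟩, rfl⟩
    obtain ⟨Q, hQ⟩ :=
      EquivLike.surjective (Matrix.toEuclideanCLM (n := Fin d) (𝕜 := ℝ)) (A : E d →L[ℝ] E d)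
    refine ⟨Q, c, EquivLike.injective (Matrix.toEuclideanCLM (n := Fin d) (𝕜 := ℝ)) ?_, fun x => ?_⟩
    · rw [← Matrix.conjTranspose_eq_transpose_of_trivial, ← Matrix.star_eq_conjTranspose, map_star,
        map_neg, hQ, mem_skew_iff_star_eq_neg.1 A.2]
    · rw [← Matrix.ofLp_toEuclideanCLM, hQ]
      rfl

lemma coe_V (hR : ∀ᵐ x ∂volume.restrict Ω, ‖x‖ ≤ R) :
    (V Ω : Set (Lp (E d) ∞ (volume.restrict Ω))) = rigidOrthogonal (volume.restrict Ω) := by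
  ext w
  change (∀ p ∈ rigidMotions d, _) ↔ ∀ q, _
  rw [rigidMotions_eq_range, Set.forall_mem_range]
  refine forall_congr' fun q => and_iff_right ?_
  exact memLp_one_iff_integrable.1 <| (memLp_rigidMotion hR q 1).of_bilin (fun x y => inner ℝ y x) 1
    (Lp.memLp w) (Lp.aestronglyMeasurable w |>.inner (memLp_rigidMotion hR q 1).1)
    (.of_forall fun x => by
      simpa [mul_comm] using nnnorm_inner_le_nnnorm (𝕜 := ℝ) (w x) (rigidMotion q x))

lemma integral_inner_rigidMotion_eq_zero_of_mem_VL2 (hR : ∀ᵐ x ∂volume.restrict Ω, ‖x‖ ≤ R)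
    {w : Lp (E d) 2 (volume.restrict Ω)} (hw : w ∈ VL2 Ω) (q : skew (E d) × E d) :
    ∫ x in Ω, inner ℝ (w x) (rigidMotion q x) = 0 := by
  set p := (memLp_rigidMotion hR q 2).toLp
  have hinner (v : Lp (E d) 2 (volume.restrict Ω)) :
      inner ℝ v p = ∫ x in Ω, inner ℝ (v x) (rigidMotion q x) :=
    integral_congr_ae <| (memLp_rigidMotion hR q 2).coeFn_toLp.mono fun x hx => by
      simp only [p, hx]
  have hclosed : IsClosed {v | inner ℝ v p = 0} := isClosed_eq (by fun_prop) continuous_const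
  rw [← hinner]
  refine closure_minimal (t := {v | inner ℝ v p = 0}) ?_ hclosed hw
  rintro v ⟨u, hu, hvu⟩
  have horth : u ∈ rigidOrthogonal (volume.restrict Ω) := coe_V hR ▸ hu
  refine (hinner v).trans ((integral_congr_ae ?_).trans (horth q))
  exact hvu.mono fun x hx => by simp only [hx]

end RigidMotions

namespace StrictlyInsideStrengthDomain

variable {d : ℕ} {Ω : Set (E d)} {ε re rc C : ℝ} {k : E d → ℝ} {h : ℝ → ℝ} {u : E d → E d}

lemma exists_bondStretches_subset_Icc (hu : StrictlyInsideStrengthDomain Ω ε re rc u) :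
    ∃ a b, Set.Icc a b ⊆ Set.Ioo re rc ∧ bondStretches Ω ε u ⊆ Set.Icc a b := by
  obtain ⟨a, b, ha, hb, hab⟩ := hu
  refine ⟨a, b, Set.Icc_subset_Ioo ha hb, ?_⟩
  rintro s ⟨x, hx, y, hy, hyx, hyε, rfl⟩
  rw [← sqrt_mul_strain]
  exact hab x hx y ⟨mem_ball_iff_norm.2 hyε, hy⟩ hyx

lemma bondStretches_subset_Ioo (hu : StrictlyInsideStrengthDomain Ω ε re rc u) :
    bondStretches Ω ε u ⊆ Set.Ioo re rc :=
  let ⟨_, _, hIoo, hsub⟩ := hu.exists_bondStretches_subset_Icc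
  hsub.trans hIoo

lemma exists_pos_mul_sq_le_inner_integral_bondField
    (hu : StrictlyInsideStrengthDomain Ω ε re rc u)
    (hum : AEStronglyMeasurable u (volume.restrict Ω))
    (hk : IsBondKernel ε k) (hΩ : MeasurableSet Ω) (hcone : InteriorConeCondition Ω) (hε : 0 < ε)
    (hh : Continuous h) (hhC : ∀ r, |h r| ≤ C) (hpos : ∀ r ∈ Set.Ioo re rc, 0 < h r) :
    ∃ γ > 0, ∀ x ∈ Ω, ∀ v, γ * ‖v‖ ^ 2 ≤ inner ℝ ((∫ y in Ω, bondField k h u x y) v) v := by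
  obtain ⟨a, b, hIoo, hsub⟩ := hu.exists_bondStretches_subset_Icc
  obtain ⟨m, hm, hle⟩ := isCompact_Icc.exists_forall_le' hh.continuousOn
    fun r hr => hpos r (hIoo hr)
  obtain ⟨s, hs, ρ, hρ, hball⟩ := hcone.exists_ball_subset hε
  exact hk.exists_pos_mul_sq_le_inner_integral_bondField hΩ hs hρ hball hh.measurable hhC hm
    (fun r hr => hle r (hsub hr)) hum

end StrictlyInsideStrengthDomain

section Conclusions

variable {d : ℕ} {Ω : Set (E d)} {ε γ C R : ℝ} {J g : ℝ → ℝ} {u : E d → E d}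

lemma mul_sq_lt_inner_stabilityTensor {x v : E d} (hγ : 0 < γ)
    (hcoercive : γ * ‖v‖ ^ 2
      ≤ inner ℝ ((∫ y in Ω, bondField (bondKernel ε J) (iteratedDeriv 2 g) u x y) v) v)
    (hv : v ≠ 0) : γ / 4 * ‖v‖ ^ 2 < inner ℝ (stabilityTensor Ω ε J g u x v) v := by
  rw [stabilityTensor_eq_smul_integral_bondField, smul_apply,
    real_inner_smul_left]
  have : 0 < γ * ‖v‖ ^ 2 := by positivity
  linarith

variable [IsFiniteMeasure (volume.restrict Ω)]

lemma eq_zero_of_mem_VL2_of_forceDeriv_ae_eq_zero (hk : IsBondKernel ε (bondKernel ε J : E d → ℝ))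
    (hΩ : IsOpen Ω) (hconn : IsConnected Ω) (hR : ∀ᵐ x ∂volume.restrict Ω, ‖x‖ ≤ R) (hε : 0 < ε)
    (hgm : Measurable (iteratedDeriv 2 g)) (hgC : ∀ r, |iteratedDeriv 2 g r| ≤ C)
    (hgpos : ∀ s ∈ bondStretches Ω ε u, 0 < iteratedDeriv 2 g s)
    (hu : AEStronglyMeasurable u (volume.restrict Ω)) {w : Lp (E d) 2 (volume.restrict Ω)}
    (hw : w ∈ VL2 Ω) (hDw : forceDeriv Ω ε J g u w =ᵐ[volume.restrict Ω] 0) : w = 0 := by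
  rw [forceDeriv_eq_neg_integral_bondField] at hDw
  exact Lp.eq_zero_iff_ae_eq_zero.2 <| hk.ae_eq_zero_of_equilibrium hΩ hconn hε hgm hgC hgpos hu
    (Lp.memLp w) (integral_inner_rigidMotion_eq_zero_of_mem_VL2 hR hw)
    (hDw.mono fun x hx => neg_eq_zero.1 hx)

lemma exists_continuousLinearEquiv_hasFDerivAt_force
    (hk : IsBondKernel ε (bondKernel ε J : E d → ℝ)) (hR : ∀ᵐ x ∂volume.restrict Ω, ‖x‖ ≤ R)
    (hg : ∀ k < 3, Differentiable ℝ (iteratedDeriv k g))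
    (hgC : ∀ k ∈ Set.Icc 1 3, ∃ C, ∀ r, |iteratedDeriv k g r| ≤ C)
    (hu : MemLp u ∞ (volume.restrict Ω)) (huV : hu.toLp u ∈ V Ω)
    {T : Lp (E d) ∞ (volume.restrict Ω) →L[ℝ] Lp (E d) ∞ (volume.restrict Ω)}
    (hT : ∀ w, T w =ᵐ[volume.restrict Ω] fun x =>
      -∫ y in Ω, bondField (bondKernel ε J) (iteratedDeriv 2 g) u x y (w y - w x))
    (hbij : Set.BijOn T (V Ω) (V Ω)) :
    ∃ T' : V Ω ≃L[ℝ] V Ω, (∀ w, (T' w).1 =ᵐ[volume.restrict Ω] forceDeriv Ω ε J g u w.1) ∧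
      ∃ L : V Ω → V Ω, (∀ v, (L v).1 =ᵐ[volume.restrict Ω] force Ω ε J g v.1) ∧
        HasFDerivAt L (T' : V Ω →L[ℝ] V Ω) ⟨hu.toLp u, huV⟩ := by
  obtain ⟨C₁, hC₁⟩ := hgC 1 (by simp)
  obtain ⟨C₂, hC₂⟩ := hgC 2 (by simp)
  obtain ⟨C₃, hC₃⟩ := hgC 3 (by simp)
  have hderiv (k : ℕ) (hk : k < 3) (r : ℝ) :
      HasDerivAt (iteratedDeriv k g) (iteratedDeriv (k + 1) g r) r := by
    rw [iteratedDeriv_succ]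
    exact (hg k hk r).hasDerivAt
  rw [iteratedDeriv_one] at hC₁
  have hgm : Measurable (deriv g) := by
    simpa only [iteratedDeriv_one] using (hg 1 (by simp)).continuous.measurable
  have htaylor := abs_sub_sub_mul_le (by simpa only [iteratedDeriv_one] using hderiv 1 (by simp))
    (hderiv 2 (by simp)) hC₃
  choose f hfV hf using fun v : Lp (E d) ∞ (volume.restrict Ω) =>
    hk.exists_rigidOrthogonal_ae_eq_force Measure.restrict_le_self hR hgm hC₁
      (Lp.aestronglyMeasurable v)
  obtain ⟨T', hT'⟩ :=
    exists_continuousLinearEquiv_of_bijOn (coe_V hR ▸ isClosed_rigidOrthogonal hR) hbij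
  refine ⟨T', fun w => ?_, fun v => ⟨f v, (coe_V hR).ge (hfV v)⟩, fun v => ?_,
    hasFDerivAt_restrict (f := f) ?_ (fun _ => rfl) hT'⟩
  · rw [hT', forceDeriv_eq_neg_integral_bondField]
    exact hT w
  · rw [force_eq_neg_integral_bondForce]
    exact hf v
  · exact hk.hasFDerivAt_force Measure.restrict_le_self hgm hC₁
      (hg 2 (by simp)).continuous.measurable hC₂ htaylor hu hf hT

end Conclusions

end Peridynamics

end

theorem theorem3p5_general {d : ℕ} (hd : 2 ≤ d)
    {Ω : Set (Peridynamics.E d)} (hΩ_open : IsOpen Ω) (hΩ_conn : IsConnected Ω)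
    (hΩ_bdd : Bornology.IsBounded Ω) (hΩ_cone : Peridynamics.InteriorConeCondition Ω)
    {ε : ℝ} (hε : 0 < ε)
    {J g : ℝ → ℝ} {re rc : ℝ} (hJ : Peridynamics.IsInfluenceFunction J)
    (hg : ∀ k < 3, Differentiable ℝ (iteratedDeriv k g))
    (hg_bdd : ∀ k ∈ Set.Icc 1 3, ∃ C, ∀ r, |iteratedDeriv k g r| ≤ C)
    (hg_pos : ∀ r ∈ Set.Ioo re rc, 0 < iteratedDeriv 2 g r)
    (u₀ : Peridynamics.E d → Peridynamics.E d) (hu₀ : MemLp u₀ ∞ (volume.restrict Ω))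
    (hu₀V : hu₀.toLp u₀ ∈ Peridynamics.V Ω)
    (hu₀S : Peridynamics.StrictlyInsideStrengthDomain Ω ε re rc u₀) :
    (∃ γ : ℝ, 0 < γ ∧ ∀ x ∈ Ω, ∀ v : Peridynamics.E d, v ≠ 0 →
      γ * ‖v‖ ^ 2 < inner ℝ (Peridynamics.stabilityTensor Ω ε J g u₀ x v) v) ∧
    (∀ w ∈ Peridynamics.VL2 Ω,
      Peridynamics.forceDeriv Ω ε J g u₀ w =ᵐ[volume.restrict Ω] 0 → w = 0) ∧
    (∃ T : Peridynamics.V Ω ≃L[ℝ] Peridynamics.V Ω,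
      (∀ w : Peridynamics.V Ω,
        ⇑(T w).1 =ᵐ[volume.restrict Ω] Peridynamics.forceDeriv Ω ε J g u₀ ⇑w.1) ∧
      ∃ L : Peridynamics.V Ω → Peridynamics.V Ω,
        (∀ u : Peridynamics.V Ω,
          ⇑(L u).1 =ᵐ[volume.restrict Ω] Peridynamics.force Ω ε J g ⇑u.1) ∧
        HasFDerivAt L (T : Peridynamics.V Ω →L[ℝ] Peridynamics.V Ω)
          ⟨hu₀.toLp u₀, hu₀V⟩) := by
  have := isFiniteMeasure_restrict.2 (hΩ_bdd.measure_lt_top (μ := volume)).ne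
  have hk := Peridynamics.isBondKernel_bondKernel hd hε hJ
  have hcont : Continuous (iteratedDeriv 2 g) := (hg 2 (by simp)).continuous
  have hpos := fun s hs => hg_pos s (hu₀S.bondStretches_subset_Ioo hs)
  obtain ⟨R, hR⟩ := hΩ_bdd.exists_norm_le
  have hR_ae := ae_restrict_of_forall_mem (μ := volume) hΩ_open.measurableSet hR
  obtain ⟨C, hC⟩ := hg_bdd 2 (by simp)
  obtain ⟨γ, hγ, hcoercive⟩ := hu₀S.exists_pos_mul_sq_le_inner_integral_bondField hu₀.1 hk
    hΩ_open.measurableSet hΩ_cone hε hcont hC hg_pos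
  obtain ⟨T, hT, hbij⟩ := hk.exists_linearization hΩ_open hΩ_conn hR_ae hε hcont hC hpos hγ
    hcoercive hu₀
  rw [← Peridynamics.coe_V hR_ae] at hbij
  exact ⟨⟨γ / 4, by positivity, fun x hx v =>
      Peridynamics.mul_sq_lt_inner_stabilityTensor hγ (hcoercive x hx v)⟩,
    fun w => Peridynamics.eq_zero_of_mem_VL2_of_forceDeriv_ae_eq_zero hk hΩ_open hΩ_conn hR_ae hε
      hcont.measurable hC hpos hu₀.1,
    Peridynamics.exists_continuousLinearEquiv_hasFDerivAt_force hk hR_ae hg hg_bdd hu₀ hu₀V hT hbij⟩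

theorem theorem3p5 {d : ℕ} (hd : d = 2 ∨ d = 3)
    {Ω : Set (Peridynamics.E d)} (hΩ_open : IsOpen Ω) (hΩ_conn : IsConnected Ω)
    (hΩ_bdd : Bornology.IsBounded Ω) (hΩ_cone : Peridynamics.InteriorConeCondition Ω)
    {ε : ℝ} (hε : 0 < ε)
    {J g : ℝ → ℝ} {re rc : ℝ} (hJ : Peridynamics.IsInfluenceFunction J)
    (hg : Peridynamics.IsCohesivePotential g re rc)
    (u₀ : Peridynamics.E d → Peridynamics.E d) (hu₀ : MemLp u₀ ∞ (volume.restrict Ω))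
    (hu₀V : hu₀.toLp u₀ ∈ Peridynamics.V Ω)
    (hu₀S : Peridynamics.StrictlyInsideStrengthDomain Ω ε re rc u₀) :
    -- uniform positive definiteness of the stability tensor
    (∃ γ : ℝ, 0 < γ ∧ ∀ x ∈ Ω, ∀ v : Peridynamics.E d, v ≠ 0 →
      γ * ‖v‖ ^ 2 < inner ℝ (Peridynamics.stabilityTensor Ω ε J g u₀ x v) v) ∧
    -- trivial kernel, already on the closure of `𝒱` in `L²`
    (∀ w ∈ Peridynamics.VL2 Ω,
      Peridynamics.forceDeriv Ω ε J g u₀ w =ᵐ[volume.restrict Ω] 0 → w = 0) ∧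
    -- `D(𝓛)[u₀]` is a bounded operator on `𝒱` with a bounded inverse, and it is the Fréchet
    -- derivative at `u₀` of the force `𝓛 : 𝒱 → 𝒱`
    (∃ T : Peridynamics.V Ω ≃L[ℝ] Peridynamics.V Ω,
      (∀ w : Peridynamics.V Ω,
        ⇑(T w).1 =ᵐ[volume.restrict Ω] Peridynamics.forceDeriv Ω ε J g u₀ ⇑w.1) ∧
      ∃ L : Peridynamics.V Ω → Peridynamics.V Ω,
        (∀ u : Peridynamics.V Ω,
          ⇑(L u).1 =ᵐ[volume.restrict Ω] Peridynamics.force Ω ε J g ⇑u.1) ∧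
        HasFDerivAt L (T : Peridynamics.V Ω →L[ℝ] Peridynamics.V Ω)
          ⟨hu₀.toLp u₀, hu₀V⟩) :=
  theorem3p5_general (by omega) hΩ_open hΩ_conn hΩ_bdd hΩ_cone hε hJ hg.differentiable
    (fun k hk => hg.bounded k hk.2) hg.second_deriv_pos u₀ hu₀ hu₀V hu₀S
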